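/- Consider $\mathcal{ALCQPIH}_{R^+}$-concepts over countable sets of concept names (non-empty) and role names: they are built from concept names by $\neg,\sqcap,\sqcup$, $\forall R.C$, $\exists R.C$, $\geqslant nR.C$, $\leqslant nR.C$ ($n\ge 0$) and the part restrictions $MrR.C$, $WrR.C$ ($r\in\mathbb Q\cap(0,1)$); roles are role names and their inverses, and roles in number and part restrictions are simple (no sub-role is transitive) with respect to the role hierarchy $\sqsubseteq^+$. Let $\sim C$ be the negation normal form (NNF) of $\neg C$, and $clos(D)$ the smallest set containing $D$ and closed under sub-concepts and $\sim$. A completion tree for $D$ is a finite tree $\mathbf T$ whose nodes $x$ carry finite sets $\mathcal L(x)$ of concepts from $clos(D)$ (or concepts $\forall R.C$ with $R$ transitive, $R\sqsubseteq^+S$, $\forall S.C\in clos(D)$), whose edges carry finite sets of roles occurring in $D$ or inverse to such roles, and whose root label contains $D$. A node $y$ is an $R$-neighbour of $x$ if $y$ is a successor of $x$ with some $S\sqsubseteq^+R$ in the label of the edge $\langle x,y\rangle$, or $x$ is a successor of $y$ with some $S\sqsubseteq^+\mathsf{Inv}(R)$ in the label of $\langle y,x\rangle$; $R^{\mathbf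 T}(x)$ is the set of $R$-neighbours of $x$ and $R^{\mathbf T}(x,C)$ the set of those whose label contains $C$. A part restriction in $\mathcal L(x)$ is $\mathbf T$-satisfied at $x$ if it causes no clash there, i.e. $\sharp R^{\mathbf T}(x,C)>r\cdot\sharp R^{\mathbf T}(x)$ for $MrR.C$, and $\sharp R^{\mathbf T}(x,\sim C)\le r\cdot\sharp R^{\mathbf T}(x)$ for $WrR.C$. The non-generating rules are the $\sqcap$-, $\sqcup$-, $\forall$-, $\forall_+$-, choose- and $\leqslant$-rule of the tableau algorithm (with pair-wise blocking). For a set $P$ of part restrictions in $\mathcal L(x)$ and a set $G$ of concepts of the forms $\exists R.C$, $\geqslant nR.C$ in $\mathcal L(x)$, say that a completion tree $\mathbf T'$ for $D$ satisfies $(P,G)$ at $x$ over $\mathbf T$ if $\mathbf T'$ differs from $\mathbf T$ at most in the proper descendants of $x$; at $x$ and at all its descendants in $\mathbf T'$ no non-generating rule is applicable, no label contains both some $C$ and $\neg C$, and no concept $\leqslant nR.C$ of a label is violated; all members of $P$ are $\mathbf T'$-satisfied at $x$; and all members of $G$ are satisfied at $x$, i.e. $\sharp R^{\mathbf T'}(x,C)\ge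 1$, respectively $\ge n$. Call $(P,G)$ simultaneously satisfiable at $x$ if such a $\mathbf T'$ exists. **Lemma.** There is a computable function which assigns to the label $\mathcal L(x)$ of a node $x$ and, if $x$ is a successor of a node $u$, to the label $\mathcal L(u)$, a natural number $BAN_x$ such that for every role hierarchy, every concept $D$ in NNF, every completion tree $\mathbf T$ for $D$ and every node $x$ of $\mathbf T$ to which no non-generating rule is applicable: 1. $1\le BAN_x\le (2n_0)^{2n_0}\cdot 2^{4n_0^2+3n_0}$, where $n_0$ is the length of $D$ (the number of its symbols, with numbers written in binary); 2. for every set $P$ of part restrictions in $\mathcal L(x)$ and every set $G$ of concepts of the forms $\exists R.C$, $\geqslant nR.C$ in $\mathcal L(x)$ such that $(P,G)$ is simultaneously satisfiable at $x$, there is a completion tree $\mathbf T'$ that satisfies $(P,G)$ at $x$ over $\mathbf T$ and in which, for every role $R$ at the uppermost level of a part restriction in $P$, the number of $R$-neighbours of $x$ does not exceed $BAN_x$. -/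

import Mathlib

/-- Roles: role names and their inverses. -/
inductive Role (ρ : Type*) where
  | name (R : ρ)
  | inv (R : ρ)

namespace Role

variable {ρ : Type*}

/-- The function `Inv`, so that `Inv (Inv R) = R`. -/
def Inv : Role ρ → Role ρ
  | name R => inv R
  | inv R => name R

/-- The underlying role name. -/
def base : Role ρ → ρ
  | name R => R
  | inv R => R

/-- Number of symbols: a role name is one symbol, the inverse sign is another one. -/
def length : Role ρ → ℕ
  | name _ => 1
  | inv _ => 2

/-- A role as a word of natural numbers. -/
def code [Encodable ρ] : Role ρ → List ℕ
  | name R => [0, Encodable.encode R]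
  | inv R => [1, Encodable.encode R]

end Role

/-- Transitive role names and role inclusion axioms. -/
structure RoleBox (ρ : Type*) where
  trans : Set ρ
  incl : Role ρ → Role ρ → Prop

namespace RoleBox

variable {ρ : Type*} (H : RoleBox ρ)

/-- The role hierarchy `⊑⁺`: the reflexive and transitive closure of the inclusion axioms
together with their inverted forms. -/
def Sub : Role ρ → Role ρ → Prop :=
  Relation.ReflTransGen fun R S => H.incl R S ∨ H.incl R.Inv S.Inv

/-- A role is transitive if it is a transitive role name or the inverse of one. -/
def Trans (R : Role ρ) : Prop := R.base ∈ H.trans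

/-- A role is simple if neither it nor any of its sub-roles is transitive. -/
def Simple (R : Role ρ) : Prop := ∀ S, H.Sub S R → ¬ H.Trans S

end RoleBox

/-- Concepts over concept names `α` and role names `ρ`. `more r R C` is the part restriction
`M r R.C` and `weak r R C` is the part restriction `W r R.C`. -/
inductive DLConcept (α ρ : Type*) where
  | atom (A : α)
  | neg (C : DLConcept α ρ)
  | and (C E : DLConcept α ρ)
  | or (C E : DLConcept α ρ)
  | all (R : Role ρ) (C : DLConcept α ρ)
  | ex (R : Role ρ) (C : DLConcept α ρ)
  | atLeast (n : ℕ) (R : Role ρ) (C : DLConcept α ρ)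
  | atMost (n : ℕ) (R : Role ρ) (C : DLConcept α ρ)
  | more (r : ℚ) (R : Role ρ) (C : DLConcept α ρ)
  | weak (r : ℚ) (R : Role ρ) (C : DLConcept α ρ)

namespace DLConcept

variable {α ρ : Type*}

/-- Syntactic side conditions: number and part restrictions use simple roles only, and the
rational number in a part restriction lies strictly between `0` and `1`. -/
def WF (H : RoleBox ρ) : DLConcept α ρ → Prop
  | atom _ => True
  | neg C => C.WF H
  | and C E => C.WF H ∧ E.WF H
  | or C E => C.WF H ∧ E.WF H
  | all _ C => C.WF H
  | ex _ C => C.WF H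
  | atLeast _ R C => H.Simple R ∧ C.WF H
  | atMost _ R C => H.Simple R ∧ C.WF H
  | more r R C => 0 < r ∧ r < 1 ∧ H.Simple R ∧ C.WF H
  | weak r R C => 0 < r ∧ r < 1 ∧ H.Simple R ∧ C.WF H

/-- Negation normal form: negation occurs only in front of concept names. -/
def IsNNF : DLConcept α ρ → Prop
  | atom _ => True
  | neg (atom _) => True
  | neg _ => False
  | and C E => C.IsNNF ∧ E.IsNNF
  | or C E => C.IsNNF ∧ E.IsNNF
  | all _ C => C.IsNNF
  | ex _ C => C.IsNNF
  | atLeast _ _ C => C.IsNNF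
  | atMost _ _ C => C.IsNNF
  | more _ _ C => C.IsNNF
  | weak _ _ C => C.IsNNF

/-- `nnf true C` is the negation normal form of `C`, and `nnf false C` that of `¬ C`.
The negation of `≥ 0 R.C` is the contradiction `A ⊓ ¬ A` for a fixed concept name `A`. -/
def nnf [Inhabited α] : Bool → DLConcept α ρ → DLConcept α ρ
  | true, atom A => atom A
  | false, atom A => neg (atom A)
  | b, neg C => nnf (!b) C
  | true, and C E => and (nnf true C) (nnf true E)
  | false, and C E => or (nnf false C) (nnf false E)
  | true, or C E => or (nnf true C) (nnf true E)
  | false, or C E => and (nnf false C) (nnf false E)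
  | true, all R C => all R (nnf true C)
  | false, all R C => ex R (nnf false C)
  | true, ex R C => ex R (nnf true C)
  | false, ex R C => all R (nnf false C)
  | true, atLeast n R C => atLeast n R (nnf true C)
  | false, atLeast 0 _ _ => and (atom default) (neg (atom default))
  | false, atLeast (n + 1) R C => atMost n R (nnf true C)
  | true, atMost n R C => atMost n R (nnf true C)
  | false, atMost n R C => atLeast (n + 1) R (nnf true C)
  | true, more r R C => more r R (nnf true C)
  | false, more r R C => weak r R (nnf false C)
  | true, weak r R C => weak r R (nnf true C)
  | false, weak r R C => more r R (nnf false C)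

/-- `∼ C`, the negation normal form of `¬ C`. -/
def compl [Inhabited α] (C : DLConcept α ρ) : DLConcept α ρ := nnf false C

/-- The immediate sub-concepts of a concept. -/
def immSub : DLConcept α ρ → Set (DLConcept α ρ)
  | atom _ => ∅
  | neg C => {C}
  | and C E => {C, E}
  | or C E => {C, E}
  | all _ C => {C}
  | ex _ C => {C}
  | atLeast _ _ C => {C}
  | atMost _ _ C => {C}
  | more _ _ C => {C}
  | weak _ _ C => {C}

/-- `Clos D C`: the concept `C` belongs to `clos(D)`, the smallest set of concepts that contains
`D` and is closed under sub-concepts and under `∼`. -/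
inductive Clos [Inhabited α] (D : DLConcept α ρ) : DLConcept α ρ → Prop
  | self : Clos D D
  | sub {C E : DLConcept α ρ} : Clos D C → E ∈ C.immSub → Clos D E
  | compl {C : DLConcept α ρ} : Clos D C → Clos D C.compl

/-- The concepts that may label nodes: those of `clos(D)` and the concepts `∀ R.C` with `R`
transitive, `R ⊑⁺ S` and `∀ S.C` in `clos(D)`, which the rule for transitive roles adds. -/
def LabelConcept [Inhabited α] (H : RoleBox ρ) (D C : DLConcept α ρ) : Prop :=
  Clos D C ∨ ∃ R S E, C = all R E ∧ Clos D (all S E) ∧ H.Sub R S ∧ H.Trans R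

/-- The roles that occur in a concept. -/
def occ : DLConcept α ρ → Set (Role ρ)
  | atom _ => ∅
  | neg C => C.occ
  | and C E => C.occ ∪ E.occ
  | or C E => C.occ ∪ E.occ
  | all R C => insert R C.occ
  | ex R C => insert R C.occ
  | atLeast _ R C => insert R C.occ
  | atMost _ R C => insert R C.occ
  | more _ R C => insert R C.occ
  | weak _ R C => insert R C.occ

/-- `R_D`: the roles that occur in a concept, and their inverses. -/
def roles (D : DLConcept α ρ) : Set (Role ρ) := {R | R ∈ D.occ ∨ R.Inv ∈ D.occ}

/-- The number of binary digits of a natural number (`0` has one digit). -/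
def digits (n : ℕ) : ℕ := max 1 n.size

/-- The length of a concept: the number of its symbols, numbers being written in binary and
rational numbers as fractions in lowest terms. Dots, parentheses and fraction bars are not
counted. -/
def length : DLConcept α ρ → ℕ
  | atom _ => 1
  | neg C => 1 + C.length
  | and C E => 1 + C.length + E.length
  | or C E => 1 + C.length + E.length
  | all R C => 1 + R.length + C.length
  | ex R C => 1 + R.length + C.length
  | atLeast n R C => 1 + digits n + R.length + C.length
  | atMost n R C => 1 + digits n + R.length + C.length
  | more r R C => 1 + digits r.num.natAbs + digits r.den + R.length + C.length
  | weak r R C => 1 + digits r.num.natAbs + digits r.den + R.length + C.length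

/-- A concept as a word of natural numbers, in prefix notation. -/
def code [Encodable α] [Encodable ρ] : DLConcept α ρ → List ℕ
  | atom A => [0, Encodable.encode A]
  | neg C => 1 :: C.code
  | and C E => 2 :: (C.code ++ E.code)
  | or C E => 3 :: (C.code ++ E.code)
  | all R C => 4 :: (R.code ++ C.code)
  | ex R C => 5 :: (R.code ++ C.code)
  | atLeast n R C => 6 :: n :: (R.code ++ C.code)
  | atMost n R C => 7 :: n :: (R.code ++ C.code)
  | more r R C => 8 :: r.num.natAbs :: r.den :: (R.code ++ C.code)
  | weak r R C => 9 :: r.num.natAbs :: r.den :: (R.code ++ C.code)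

/-- `C.IsPartOn R`: `C` is a part restriction whose uppermost role is `R`. -/
def IsPartOn (R : Role ρ) (C : DLConcept α ρ) : Prop :=
  ∃ r E, C = more r R E ∨ C = weak r R E

/-- Part restrictions. -/
def IsPart (C : DLConcept α ρ) : Prop := ∃ R, C.IsPartOn R

/-- The concepts `∃ R.C` and `≥ n R.C`. -/
def IsAtLeast (C : DLConcept α ρ) : Prop :=
  (∃ R E, C = ex R E) ∨ ∃ n R E, C = atLeast n R E

/-- `Box R C F`: the concept `F` is `⊠ R.C`, where `⊠` is one of `∃`, `≥ n`, `≤ n`, `M r`,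
`W r`. -/
def Box (R : Role ρ) (C F : DLConcept α ρ) : Prop :=
  F = ex R C ∨ (∃ n, F = atLeast n R C ∨ F = atMost n R C) ∨
    ∃ r, F = more r R C ∨ F = weak r R C

end DLConcept

/-- A finite tree whose nodes and edges are labelled with finite sets of concepts and of roles.
Nodes are addresses: `[]` is the root, and the successors of the node `x` are the nodes `i :: x`.
`edge (i :: x)` is the label of the edge from `x` to `i :: x`. -/
structure LTree (α ρ : Type*) where
  nodes : Finset (List ℕ)
  root_mem : [] ∈ nodes
  pred_mem : ∀ i x, i :: x ∈ nodes → x ∈ nodes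
  label : List ℕ → Finset (DLConcept α ρ)
  edge : List ℕ → Finset (Role ρ)

namespace LTree

variable {α ρ : Type*}

/-- The label of the predecessor of a node, if the node is not the root. -/
def predLabel (T : LTree α ρ) : List ℕ → Option (Finset (DLConcept α ρ))
  | [] => none
  | _ :: u => some (T.label u)

/-- Completion trees for `D`: nodes are labelled with concepts that arise from `D`, edges with
roles in `R_D`, and the root is labelled with `D`. -/
def IsCompletionTree [Inhabited α] (H : RoleBox ρ) (D : DLConcept α ρ) (T : LTree α ρ) : Prop :=
  D ∈ T.label [] ∧
  (∀ x ∈ T.nodes, ∀ C ∈ T.label x, DLConcept.LabelConcept H D C) ∧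
  ∀ i x, i :: x ∈ T.nodes → ∀ R ∈ T.edge (i :: x), R ∈ D.roles

/-- `y` is a successor of `x`. -/
def IsSucc (T : LTree α ρ) (x y : List ℕ) : Prop := y ∈ T.nodes ∧ ∃ i, y = i :: x

/-- `y` is an `R`-successor of `x`. -/
def IsRSucc (H : RoleBox ρ) (T : LTree α ρ) (R : Role ρ) (x y : List ℕ) : Prop :=
  T.IsSucc x y ∧ ∃ S ∈ T.edge y, H.Sub S R

open Classical in
/-- `R^T(x)`, the set of `R`-neighbours of `x`. -/
noncomputable def nbrs (H : RoleBox ρ) (T : LTree α ρ) (R : Role ρ) (x : List ℕ) :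
    Finset (List ℕ) :=
  T.nodes.filter fun y => T.IsRSucc H R x y ∨ T.IsRSucc H R.Inv y x

open Classical in
/-- `R^T(x, C)`, the set of `R`-neighbours of `x` labelled with `C`. -/
noncomputable def nbrsWith (H : RoleBox ρ) (T : LTree α ρ) (R : Role ρ) (x : List ℕ)
    (C : DLConcept α ρ) : Finset (List ℕ) :=
  (T.nbrs H R x).filter fun y => C ∈ T.label y

/-- The roles labelling the connection from `x` to its neighbour `y`, read from `x` to `y`:
if `y` is the predecessor of `x`, these are the inverses of the roles labelling the edge. -/
def link (T : LTree α ρ) (x y : List ℕ) : Set (Role ρ) :=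
  {S | (T.IsSucc x y ∧ S ∈ T.edge y) ∨ (T.IsSucc y x ∧ S.Inv ∈ T.edge x)}

/-- The node `x` and a proper ancestor `y` of it carry the same label, so do their predecessors,
and so do the edges leading to them. -/
def PairMatch (T : LTree α ρ) : List ℕ → Prop
  | [] => False
  | i :: u => ∃ j v, (j :: v) <:+ u ∧ T.label (i :: u) = T.label (j :: v) ∧
      T.label u = T.label v ∧ T.edge (i :: u) = T.edge (j :: v)

/-- Blocked nodes (pair-wise blocking). A node is indirectly blocked if its predecessor is
blocked or if the edge leading to it has the empty label; it is directly blocked if no ancestor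
is blocked and it matches a proper ancestor. As all descendants of a blocked node are blocked,
the condition on the ancestors can be dropped in the disjunction. -/
def Blocked (T : LTree α ρ) : List ℕ → Prop
  | [] => False
  | i :: u => T.Blocked u ∨ T.edge (i :: u) = ∅ ∨ T.PairMatch (i :: u)

/-- Indirectly blocked nodes. -/
def IndirectlyBlocked (T : LTree α ρ) : List ℕ → Prop
  | [] => False
  | i :: u => T.Blocked u ∨ T.edge (i :: u) = ∅

section Rules

variable (H : RoleBox ρ) (T : LTree α ρ) (x : List ℕ)

/-- The `⊓`-rule is applicable to `x`. -/
def AndApplicable : Prop :=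
  ¬ T.IndirectlyBlocked x ∧ ∃ C E, DLConcept.and C E ∈ T.label x ∧
    ¬ (C ∈ T.label x ∧ E ∈ T.label x)

/-- The `⊔`-rule is applicable to `x`. -/
def OrApplicable : Prop :=
  ¬ T.IndirectlyBlocked x ∧ ∃ C E, DLConcept.or C E ∈ T.label x ∧
    C ∉ T.label x ∧ E ∉ T.label x

/-- The `∀`-rule is applicable to `x`. -/
def AllApplicable : Prop :=
  ¬ T.IndirectlyBlocked x ∧ ∃ R C, DLConcept.all R C ∈ T.label x ∧
    ∃ y ∈ T.nbrs H R x, C ∉ T.label y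

/-- The `∀₊`-rule is applicable to `x`. -/
def AllTransApplicable : Prop :=
  ¬ T.IndirectlyBlocked x ∧ ∃ R S C, DLConcept.all S C ∈ T.label x ∧ H.Trans R ∧ H.Sub R S ∧
    ∃ y ∈ T.nbrs H R x, DLConcept.all R C ∉ T.label y

/-- The choose-rule is applicable to `x`. -/
def ChooseApplicable [Inhabited α] : Prop :=
  ¬ T.IndirectlyBlocked x ∧ ∃ R C, (∃ F ∈ T.label x, DLConcept.Box R C F) ∧
    ∃ y ∈ T.nbrs H R x, C ∉ T.label y ∧ C.compl ∉ T.label y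

/-- The `≤`-rule is applicable to `x`. -/
def AtMostApplicable : Prop :=
  ¬ T.IndirectlyBlocked x ∧ ∃ n R C, DLConcept.atMost n R C ∈ T.label x ∧
    n < (T.nbrsWith H R x C).card ∧
    ∃ y ∈ T.nbrsWith H R x C, ∃ z ∈ T.nbrsWith H R x C,
      y ≠ z ∧ Disjoint (T.link x y) (T.link x z) ∧ ¬ T.IsSucc y x

/-- No non-generating rule is applicable to `x`. -/
def NonGeneratingDone [Inhabited α] : Prop :=
  ¬ T.AndApplicable x ∧ ¬ T.OrApplicable x ∧ ¬ T.AllApplicable H x ∧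
    ¬ T.AllTransApplicable H x ∧ ¬ T.ChooseApplicable H x ∧ ¬ T.AtMostApplicable H x

/-- A clash `{C, ¬ C} ⊆ L(x)`. -/
def NegClash : Prop := ∃ C, C ∈ T.label x ∧ DLConcept.neg C ∈ T.label x

/-- A clash with a concept `≤ n R.C` in `L(x)`. -/
def AtMostClash : Prop :=
  ∃ n R C, DLConcept.atMost n R C ∈ T.label x ∧ n < (T.nbrsWith H R x C).card

/-- The part restriction is violated at `x`, i.e. there is a clash with it if it is in `L(x)`. -/
def PartClash [Inhabited α] : DLConcept α ρ → Prop
  | .more r R C => ((T.nbrsWith H R x C).card : ℚ) ≤ r * (T.nbrs H R x).card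
  | .weak r R C => r * (T.nbrs H R x).card < ((T.nbrsWith H R x C.compl).card : ℚ)
  | _ => False

/-- A concept `∃ R.C` or `≥ n R.C` is not yet satisfied at `x`. -/
def AtLeastLacking : DLConcept α ρ → Prop
  | .ex R C => T.nbrsWith H R x C = ∅
  | .atLeast n R C => (T.nbrsWith H R x C).card < n
  | _ => False

end Rules

/-- `T'` coincides with `T` except possibly at the proper descendants of `x`. -/
def AgreeOff (x : List ℕ) (T T' : LTree α ρ) : Prop :=
  ∀ z, (x <:+ z → z = x) →
    (z ∈ T'.nodes ↔ z ∈ T.nodes) ∧ T'.label z = T.label z ∧ T'.edge z = T.edge z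

/-- `T'` is a completion tree for `D` which differs from `T` at most in the proper descendants of
`x`, in which at `x` and below no non-generating rule is applicable and there is neither a clash
`{C, ¬ C}` nor a clash with an at-most restriction, in which all part restrictions in `P` are
`T'`-satisfied at `x` (there is no clash with them), and in which the concepts in `G` (of the
form `∃ R.C` or `≥ n R.C`) are satisfied at `x`. -/
def Satisfies [Inhabited α] (H : RoleBox ρ) (D : DLConcept α ρ) (T : LTree α ρ) (x : List ℕ)
    (P G : Set (DLConcept α ρ)) (T' : LTree α ρ) : Prop :=
  T'.IsCompletionTree H D ∧ AgreeOff x T T' ∧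
  (∀ z ∈ T'.nodes, x <:+ z →
    T'.NonGeneratingDone H z ∧ ¬ T'.NegClash z ∧ ¬ T'.AtMostClash H z) ∧
  (∀ C ∈ P, ¬ T'.PartClash H x C) ∧
  ∀ C ∈ G, ¬ T'.AtLeastLacking H x C

/-- The part restrictions in `P`, together with the concepts in `G`, are simultaneously
satisfiable at the node `x` of `T`. -/
def SimSatisfiable [Inhabited α] (H : RoleBox ρ) (D : DLConcept α ρ) (T : LTree α ρ) (x : List ℕ)
    (P G : Set (DLConcept α ρ)) : Prop :=
  ∃ T', Satisfies H D T x P G T'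

end LTree

/-- A function of a node label and of the optional label of the predecessor is computable if a
computable function yields its value from any enumeration of the labels without repetitions,
concepts being written as words. -/
def LabelComputable {α ρ : Type*} [Encodable α] [Encodable ρ]
    (B : Finset (DLConcept α ρ) → Option (Finset (DLConcept α ρ)) → ℕ) : Prop :=
  ∃ f : List (List ℕ) → Option (List (List ℕ)) → ℕ, Computable₂ f ∧
    (∀ (L : Finset (DLConcept α ρ)) (l : List (DLConcept α ρ)), L.val = (l : Multiset _) →
      B L none = f (l.map DLConcept.code) none) ∧
    ∀ (L M : Finset (DLConcept α ρ)) (l m : List (DLConcept α ρ)), L.val = (l : Multiset _) →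
      M.val = (m : Multiset _) →
      B L (some M) = f (l.map DLConcept.code) (some (m.map DLConcept.code))

/-! ### The Steinitz lemma in the maximum norm. -/

section Steinitz

variable {Y ι : Type*}

/-! Each part restriction in `P` and each at-least concept in `G` is a linear inequality with
integer coefficients in the numbers of neighbours of `x`: every neighbour contributes a vector with
one coordinate per concept, and the sum of these vectors must reach a prescribed demand
(`demand_le_balance_iff`).

In a tree satisfying `(P, G)`, successors of `x` can be deleted together with their subtrees. Labels
stay as they are, neighbour sets only shrink and blocking depends only on a node, its ancestors and
the edges leading to them; so no non-generating rule becomes applicable and no at-most restriction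
becomes violated. Only the linear inequalities have to be preserved (`LTree.Satisfies.prune`).

It remains to select few vectors whose sum still reaches the demand (`exists_small_subset`). Let `S`
be a smallest such set among `d`-dimensional vectors of norm at most `Δ`. Adding negative unit
vectors for the slack and one vector `-b` makes the total `0`, and by the Steinitz lemma the vectors
can be ordered so that all partial sums lie in a cube of side `2dΔ`. If `S` had more than
`2(2dΔ+1)^d` members, two partial sums would agree with `-b` in both or in neither; the block
between them sums to `0`, so its members from `S` use up only slack and can be removed,
contradicting minimality.

The bound is computed from the label: `d` is at most the number of label concepts that carry an
inequality, and `Δ` exceeds the sum of their coefficient bounds. Since the closure of `D` contains,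
up to trivial concepts, only `E`, `∼E` and `∼∼E` for sub-concepts `E` of `D` (`Clos.mem_variants`),
there are at most `n₀` such concepts, with coefficients at most `2^n₀`. -/

/-- Moving along `g` from an interior point of a cube until a face of the cube is reached. -/
theorem exists_step_to_face (F : Finset Y) (l g : Y → ℚ) (hl : ∀ y ∈ F, 0 < l y ∧ l y < 1)
    (hg : ∃ y ∈ F, g y ≠ 0) :
    ∃ t : ℚ, (∀ y ∈ F, 0 ≤ l y + t * g y ∧ l y + t * g y ≤ 1) ∧
      ∃ y ∈ F, l y + t * g y = 0 ∨ l y + t * g y = 1 := by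
  classical
  obtain ⟨y₀, hy₀, hy₀'⟩ := hg
  -- The time at which coordinate `y` leaves the unit interval; the smallest one is the admissible
  -- step. Coordinates with `g y = 0` never leave and are filtered out below.
  let τ : Y → ℚ := fun y => if 0 < g y then (1 - l y) / g y else l y / (-g y)
  obtain ⟨z, hz, hmin⟩ := (F.filter fun y => g y ≠ 0).exists_min_image τ
    ⟨y₀, Finset.mem_filter.2 ⟨hy₀, hy₀'⟩⟩
  rw [Finset.mem_filter] at hz
  have hτ : ∀ y ∈ F, 0 ≤ τ y := by
    intro y hy
    have := hl y hy
    simp only [τ]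
    split_ifs with h
    · exact div_nonneg (by linarith) h.le
    · exact div_nonneg this.1.le (by linarith)
  refine ⟨τ z, fun y hy => ?_, z, hz.1, ?_⟩
  · have hly := hl y hy
    have h0 := hτ z hz.1
    rcases lt_trichotomy (g y) 0 with h | h | h
    · have hm := hmin y (Finset.mem_filter.2 ⟨hy, h.ne⟩)
      have e : τ y = l y / (-g y) := if_neg (not_lt.2 h.le)
      rw [e, le_div_iff₀ (by linarith)] at hm
      constructor
      · linarith
      · nlinarith
    · rw [h]
      constructor <;> linarith
    · have hm := hmin y (Finset.mem_filter.2 ⟨hy, h.ne'⟩)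
      have e : τ y = (1 - l y) / g y := if_pos h
      rw [e, le_div_iff₀ h] at hm
      constructor
      · nlinarith
      · linarith
  · rcases lt_or_gt_of_ne hz.2 with h | h
    · left
      have e : τ z = l z / (-g z) := if_neg (not_lt.2 h.le)
      rw [e, div_neg, neg_mul, div_mul_cancel₀ _ hz.2]
      ring
    · right
      have e : τ z = (1 - l z) / g z := if_pos h
      rw [e, div_mul_cancel₀ _ hz.2]
      ring

/-- More than `card ι + 1` vectors have a nontrivial linear relation with coefficient sum `0`. -/
theorem exists_affine_relation [Fintype ι] (F : Finset Y) (v : Y → ι → ℚ)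
    (h : Fintype.card ι + 1 < F.card) :
    ∃ g : Y → ℚ, (∀ y, y ∉ F → g y = 0) ∧ ∑ y ∈ F, g y = 0 ∧
      (∀ i, ∑ y ∈ F, g y * v y i = 0) ∧ ∃ y ∈ F, g y ≠ 0 := by
  classical
  -- The additional coordinate `1` turns a linear relation into one with coefficient sum `0`.
  have hli : ¬ LinearIndependent ℚ (fun y : F => ((1 : ℚ), v y)) := by
    intro hli
    have := hli.fintype_card_le_finrank
    simp only [Fintype.card_coe, Module.finrank_prod, Module.finrank_self,
      Module.finrank_fintype_fun_eq_card] at this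
    omega
  rw [Fintype.not_linearIndependent_iff] at hli
  obtain ⟨g, hg, y, hy⟩ := hli
  have h1 := congrArg Prod.fst hg
  have h2 := congrArg Prod.snd hg
  simp only [Prod.fst_sum, Prod.smul_fst, smul_eq_mul, mul_one, Prod.fst_zero] at h1
  simp only [Prod.snd_sum, Prod.smul_snd, Prod.snd_zero] at h2
  refine ⟨fun y => if h : y ∈ F then g ⟨y, h⟩ else 0, fun y hy => dif_neg hy, ?_, fun i => ?_,
    y, y.2, ?_⟩
  · rw [← Finset.sum_coe_sort]
    simpa using h1
  · rw [← Finset.sum_coe_sort]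
    have := congrFun h2 i
    simpa [Finset.sum_apply] using this
  · simpa using hy

/-- A point of a cube can be moved, preserving its coordinate sum and the given linear forms, to a
point with at most `card ι + 1` coordinates different from `0` and `1`. -/
theorem exists_few_fractional [Fintype ι] (A : Finset Y) (v : Y → ι → ℚ) (s : ℚ) (u : ι → ℚ) :
    ∀ (n : ℕ) (l : Y → ℚ), (A.filter fun y => 0 < l y ∧ l y < 1).card ≤ n →
      (∀ y ∈ A, 0 ≤ l y ∧ l y ≤ 1) → ∑ y ∈ A, l y = s → (∀ i, ∑ y ∈ A, l y * v y i = u i) →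
      ∃ m : Y → ℚ, (A.filter fun y => 0 < m y ∧ m y < 1).card ≤ Fintype.card ι + 1 ∧
        (∀ y ∈ A, 0 ≤ m y ∧ m y ≤ 1) ∧ ∑ y ∈ A, m y = s ∧ ∀ i, ∑ y ∈ A, m y * v y i = u i := by
  classical
  intro n
  induction n with
  | zero => exact fun l h h1 h2 h3 => ⟨l, h.trans (Nat.zero_le _), h1, h2, h3⟩
  | succ n ih =>
    intro l hn h1 h2 h3
    by_cases hc : (A.filter fun y => 0 < l y ∧ l y < 1).card ≤ Fintype.card ι + 1
    · exact ⟨l, hc, h1, h2, h3⟩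
    set F := A.filter fun y => 0 < l y ∧ l y < 1 with hF
    have hFA : F ⊆ A := Finset.filter_subset _ _
    obtain ⟨g, g0, gs, gv, gne⟩ := exists_affine_relation F v (not_le.1 hc)
    obtain ⟨t, ht, z, hz, hz'⟩ := exists_step_to_face F l g
      (fun y hy => (Finset.mem_filter.1 hy).2) gne
    refine ih (fun y => l y + t * g y) ?_ (fun y hy => ?_) ?_ fun i => ?_
    -- Coordinates already equal to `0` or `1` do not move, as `g` vanishes outside `F`, and `z` has
    -- reached a face.
    · have hsub : (A.filter fun y => 0 < l y + t * g y ∧ l y + t * g y < 1) ⊆ F.erase z := by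
        intro y hy
        rw [Finset.mem_filter] at hy
        rw [Finset.mem_erase]
        refine ⟨?_, ?_⟩
        · rintro rfl
          rcases hz' with h | h <;> rw [h] at hy <;> simp at hy
        · by_contra hyF
          have := g0 y hyF
          rw [this] at hy
          exact hyF (Finset.mem_filter.2 ⟨hy.1, by simpa using hy.2⟩)
      have := Finset.card_le_card hsub
      rw [Finset.card_erase_of_mem hz] at this
      omega
    · by_cases hyF : y ∈ F
      · exact ht y hyF
      · simpa [g0 y hyF] using h1 y hy
    · rw [Finset.sum_add_distrib, ← Finset.mul_sum, h2,
        ← Finset.sum_subset hFA fun y _ hy => g0 y hy, gs]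
      ring
    · simp only [add_mul, mul_assoc]
      rw [Finset.sum_add_distrib, ← Finset.mul_sum, h3,
        ← Finset.sum_subset hFA fun y _ hy => by rw [g0 y hy, zero_mul], gv]
      ring

/-- The invariant in the proof of the Steinitz lemma. -/
def SteinitzGood [Fintype ι] (v : Y → ι → ℚ) (A : Finset Y) : Prop :=
  A.card ≤ Fintype.card ι ∨ ∃ l : Y → ℚ, (∀ y ∈ A, 0 ≤ l y ∧ l y ≤ 1) ∧
    ∑ y ∈ A, l y = A.card - Fintype.card ι ∧ ∀ i, ∑ y ∈ A, l y * v y i = 0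

/-- Let `d` be the dimension and `k = A.card > d + 1`. Scaling the weights by `(k-1-d)/(k-d)` gives
them the sum `k-1-d`, and then all but `f ≤ d+1` of them can be made `0` or `1`. If no weight were
`0`, the `f` fractional ones would sum to `f-1-d ≤ 0`, which is impossible, also for `f = 0`. A
vector of weight `0` can be dropped without changing the sums. -/
theorem SteinitzGood.exists_erase [Fintype ι] [DecidableEq Y] {v : Y → ι → ℚ} {A : Finset Y}
    (h : SteinitzGood v A) (hA : A.Nonempty) : ∃ y ∈ A, SteinitzGood v (A.erase y) := by
  by_cases hc : A.card ≤ Fintype.card ι + 1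
  · obtain ⟨y, hy⟩ := hA
    refine ⟨y, hy, Or.inl ?_⟩
    rw [Finset.card_erase_of_mem hy]
    omega
  rcases h with h | ⟨l, h1, h2, h3⟩
  · omega
  have hc' : (Fintype.card ι : ℚ) + 1 < A.card := by exact_mod_cast not_le.1 hc
  set d : ℚ := ((Fintype.card ι : ℕ) : ℚ) with hd
  set k : ℚ := ((A.card : ℕ) : ℚ) with hk
  have hq0 : 0 ≤ (k - 1 - d) / (k - d) := div_nonneg (by linarith) (by linarith)
  have hq1 : (k - 1 - d) / (k - d) ≤ 1 := (div_le_one (by linarith)).2 (by linarith)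
  obtain ⟨m, hm, m1, m2, m3⟩ := exists_few_fractional A v (k - 1 - d) 0 _
    (fun y => (k - 1 - d) / (k - d) * l y) le_rfl
    (fun y hy => ⟨mul_nonneg hq0 (h1 y hy).1, mul_le_one₀ hq1 (h1 y hy).1 (h1 y hy).2⟩)
    (by rw [← Finset.mul_sum, h2, div_mul_cancel₀ _ (by linarith)])
    (fun i => by simp only [mul_assoc]; rw [← Finset.mul_sum, h3]; simp)
  have hzero : ∃ y ∈ A, m y = 0 := by
    by_contra! hne
    set F := A.filter fun y => 0 < m y ∧ m y < 1 with hF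
    have hone : ∀ y ∈ A \ F, m y = 1 := by
      intro y hy
      rw [Finset.mem_sdiff, hF, Finset.mem_filter] at hy
      have h01 := m1 y hy.1
      by_contra h
      exact hy.2 ⟨hy.1, lt_of_le_of_ne h01.1 (hne y hy.1).symm, lt_of_le_of_ne h01.2 h⟩
    have hFA : F ⊆ A := Finset.filter_subset _ _
    have hsum := Finset.sum_sdiff (f := m) hFA
    rw [Finset.sum_congr rfl hone, m2, Finset.sum_const, nsmul_eq_mul, mul_one,
      Finset.card_sdiff_of_subset hFA, Nat.cast_sub (Finset.card_le_card hFA)] at hsum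
    have hmq : (F.card : ℚ) ≤ d + 1 := by rw [hd]; exact_mod_cast hm
    rcases F.eq_empty_or_nonempty with h | h
    · rw [h] at hsum
      simp only [Finset.card_empty, Finset.sum_empty, Nat.cast_zero] at hsum
      have : 0 ≤ d := by rw [hd]; positivity
      linarith
    · have := Finset.sum_pos (f := m) (fun y hy => ((Finset.mem_filter.1 hy).2).1) h
      linarith
  obtain ⟨y, hy, hy0⟩ := hzero
  refine ⟨y, hy, Or.inr ⟨m, fun z hz => m1 z (Finset.mem_of_mem_erase hz), ?_, fun i => ?_⟩⟩
  · rw [Finset.sum_erase _ hy0, m2, Finset.card_erase_of_mem hy,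
      Nat.cast_sub (Finset.card_pos.2 hA)]
    push_cast
    ring
  · rw [Finset.sum_erase _ (by rw [hy0, zero_mul]), m3]
    rfl

/-- As `∑ l y * v y i = 0`, the weights `l y` may be replaced by `1 - l y`, which are nonnegative
with sum equal to the dimension. -/
theorem SteinitzGood.abs_sum_le [Fintype ι] {v : Y → ι → ℚ} {A : Finset Y}
    (h : SteinitzGood v A) {Δ : ℚ} (hΔ : 0 ≤ Δ) (hv : ∀ y ∈ A, ∀ i, |v y i| ≤ Δ) (i : ι) :
    |∑ y ∈ A, v y i| ≤ Fintype.card ι * Δ := by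
  rcases h with h | ⟨l, h1, h2, h3⟩
  · calc |∑ y ∈ A, v y i| ≤ ∑ y ∈ A, |v y i| := Finset.abs_sum_le_sum_abs _ _
      _ ≤ ∑ _y ∈ A, Δ := Finset.sum_le_sum fun y hy => hv y hy i
      _ = A.card * Δ := by rw [Finset.sum_const, nsmul_eq_mul]
      _ ≤ _ := mul_le_mul_of_nonneg_right (by exact_mod_cast h) hΔ
  · calc |∑ y ∈ A, v y i| = |∑ y ∈ A, (1 - l y) * v y i| := by
          simp only [sub_mul, one_mul, Finset.sum_sub_distrib, h3, sub_zero]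
      _ ≤ ∑ y ∈ A, |(1 - l y) * v y i| := Finset.abs_sum_le_sum_abs _ _
      _ ≤ ∑ y ∈ A, (1 - l y) * Δ := by
          refine Finset.sum_le_sum fun y hy => ?_
          have h0 : 0 ≤ 1 - l y := by linarith [(h1 y hy).2]
          rw [abs_mul, abs_of_nonneg h0]
          exact mul_le_mul_of_nonneg_left (hv y hy i) h0
      _ = _ := by
          rw [← Finset.sum_mul, Finset.sum_sub_distrib, h2, Finset.sum_const, nsmul_eq_mul]
          ring

/-- Every good set is the last member of a chain of good sets. -/
theorem SteinitzGood.exists_chain [Fintype ι] [DecidableEq Y] {v : Y → ι → ℚ} :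
    ∀ (n : ℕ) (A : Finset Y), A.card = n → SteinitzGood v A →
      ∃ c : ℕ → Finset Y, Monotone c ∧ (∀ k, c k ⊆ A) ∧ (∀ k ≤ n, (c k).card = k) ∧
        ∀ k, SteinitzGood v (c k) := by
  intro n
  induction n with
  | zero =>
    intro A hA h
    exact ⟨fun _ => A, monotone_const, fun _ => le_rfl, fun k hk => by dsimp only; omega,
      fun _ => h⟩
  | succ n ih =>
    intro A hA h
    obtain ⟨y, hy, hgood⟩ := h.exists_erase (Finset.card_pos.1 (by omega))
    obtain ⟨c, c1, c2, c3, c4⟩ := ih (A.erase y)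
      (by rw [Finset.card_erase_of_mem hy]; omega) hgood
    have hsub : ∀ k, c k ⊆ A := fun k => (c2 k).trans (Finset.erase_subset _ _)
    refine ⟨fun k => if k ≤ n then c k else A, fun a b hab => ?_, fun k => ?_, fun k hk => ?_,
      fun k => ?_⟩
    · dsimp only
      split_ifs with ha hb
      · exact c1 hab
      · exact hsub a
      · omega
      · exact le_rfl
    · dsimp only
      split_ifs
      exacts [hsub k, le_rfl]
    · dsimp only
      split_ifs with hk'
      · exact c3 k hk'
      · omega
    · dsimp only
      split_ifs
      exacts [c4 k, h]

/-- The Steinitz lemma in the maximum norm: vectors with sum `0` can be arranged so that all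
partial sums are bounded by the dimension times the bound of the vectors. -/
theorem steinitz [Fintype ι] [DecidableEq Y] (A : Finset Y) (v : Y → ι → ℤ) (Δ : ℕ)
    (hv : ∀ y ∈ A, ∀ i, |v y i| ≤ Δ) (h0 : ∀ i, ∑ y ∈ A, v y i = 0) :
    ∃ c : ℕ → Finset Y, Monotone c ∧ (∀ k, c k ⊆ A) ∧ (∀ k ≤ A.card, (c k).card = k) ∧
      ∀ k i, |∑ y ∈ c k, v y i| ≤ Fintype.card ι * Δ := by
  have hgood : SteinitzGood (fun y i => (v y i : ℚ)) A := by
    by_cases hc : A.card ≤ Fintype.card ι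
    · exact Or.inl hc
    have hc' : (Fintype.card ι : ℚ) < A.card := by exact_mod_cast not_le.1 hc
    have hd : (0 : ℚ) ≤ Fintype.card ι := by positivity
    have hpos : (0 : ℚ) < A.card := by linarith
    -- Equal weights serve for the whole set because its vectors sum to `0`.
    refine Or.inr ⟨fun _ => (A.card - Fintype.card ι) / A.card, fun y _ => ⟨?_, ?_⟩, ?_,
      fun i => ?_⟩
    · exact div_nonneg (by linarith) hpos.le
    · exact (div_le_one hpos).2 (by linarith)
    · rw [Finset.sum_const, nsmul_eq_mul]
      field_simp
    · rw [← Finset.mul_sum]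
      have := h0 i
      rw [← Int.cast_sum, this]
      simp
  obtain ⟨c, c1, c2, c3, c4⟩ := hgood.exists_chain _ A rfl
  refine ⟨c, c1, c2, c3, fun k i => ?_⟩
  have := (c4 k).abs_sum_le (Δ := Δ) (by positivity) (fun y hy i => by exact_mod_cast hv y (c2 k hy) i) i
  exact_mod_cast this

end Steinitz

/-! ### Selecting few vectors. -/

/-- From integer vectors whose sum is at least `b`, few vectors can be selected whose sum is still
at least `b`. -/
theorem exists_small_subset {Y ι : Type*} [Fintype ι] (A : Finset Y)
    (v : Y → ι → ℤ) (b : ι → ℤ) (Δ : ℕ) (hΔ : 1 ≤ Δ) (hv : ∀ y ∈ A, ∀ i, |v y i| ≤ Δ)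
    (hb : ∀ i, |b i| ≤ Δ) (hA : ∀ i, b i ≤ ∑ y ∈ A, v y i) :
    ∃ S ⊆ A, (∀ i, b i ≤ ∑ y ∈ S, v y i) ∧
      S.card ≤ 2 * (2 * Fintype.card ι * Δ + 1) ^ Fintype.card ι := by
  classical
  obtain ⟨S, hS, hmin⟩ := (A.powerset.filter fun S => ∀ i, b i ≤ ∑ y ∈ S, v y i).exists_min_image
    Finset.card ⟨A, by simpa using hA⟩
  rw [Finset.mem_filter, Finset.mem_powerset] at hS
  refine ⟨S, hS.1, hS.2, ?_⟩
  by_contra! hlarge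
  -- the vectors of `S`, the slack as copies of negative unit vectors, and the vector `-b`
  let s : ι → ℕ := fun i => (∑ y ∈ S, v y i - b i).toNat
  have hs : ∀ i, (s i : ℤ) = ∑ y ∈ S, v y i - b i := fun i =>
    Int.toNat_of_nonneg (by linarith [hS.2 i])
  let E : Finset (Y ⊕ ((Σ i, Fin (s i)) ⊕ Unit)) := S.disjSum Finset.univ
  let w : Y ⊕ ((Σ i, Fin (s i)) ⊕ Unit) → ι → ℤ := fun e i => match e with
    | .inl y => v y i
    | .inr (.inl p) => if p.1 = i then -1 else 0
    | .inr (.inr _) => -b i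
  have hwb : ∀ e ∈ E, ∀ i, |w e i| ≤ Δ := by
    rintro (y | p | u) he i
    · exact hv y (hS.1 (Finset.inl_mem_disjSum.1 he)) i
    · change |if p.1 = i then (-1 : ℤ) else 0| ≤ Δ
      split_ifs
      · simpa using hΔ
      · simp
    · change |-b i| ≤ Δ
      rw [abs_neg]
      exact hb i
  have hw0 : ∀ i, ∑ e ∈ E, w e i = 0 := by
    intro i
    have h1 : ∑ p : Σ i, Fin (s i), (if p.1 = i then (-1 : ℤ) else 0) = -s i := by
      rw [Fintype.sum_sigma, Finset.sum_eq_single i]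
      · simp
      · intro i' _ hi'
        simp [hi']
      · simp
    rw [Finset.sum_disjSum, Fintype.sum_sum_type]
    simp only [w, h1, hs, Finset.univ_unique, Finset.sum_singleton]
    ring
  obtain ⟨c, cmono, csub, ccard, cbound⟩ := steinitz E w Δ hwb hw0
  have hEcard : S.card ≤ E.card := by
    rw [Finset.card_disjSum]
    omega
  -- The possible partial sums, together with a bit recording whether `-b` has already been used;
  -- this bit is the source of the leading factor `2`.
  let B : Finset ((ι → ℤ) × Bool) :=
    (Fintype.piFinset fun _ => Finset.Icc (-(Fintype.card ι * Δ : ℤ)) (Fintype.card ι * Δ)) ×ˢ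
      Finset.univ
  have hB : B.card = 2 * (2 * Fintype.card ι * Δ + 1) ^ Fintype.card ι := by
    rw [Finset.card_product, Fintype.card_piFinset, Finset.prod_const, Finset.card_univ,
      Finset.card_univ, Fintype.card_bool, Int.card_Icc, mul_comm]
    congr 2
    have : (0 : ℤ) ≤ Fintype.card ι * Δ := by positivity
    zify
    rw [Int.toNat_of_nonneg (by linarith)]
    ring
  obtain ⟨j, hj, k, hk, hjk, hcol⟩ := Finset.exists_ne_map_eq_of_card_lt_of_maps_to
    (s := Finset.range (E.card + 1)) (t := B)
    (f := fun k => (fun i => ∑ e ∈ c k, w e i, decide (Sum.inr (Sum.inr ()) ∈ c k)))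
    (by rw [Finset.card_range, hB]; omega)
    (by
      intro k _
      simp only [B, Finset.coe_product, Finset.coe_univ, Set.mem_prod, Set.mem_univ, and_true,
        Finset.mem_coe, Fintype.mem_piFinset, Finset.mem_Icc]
      exact fun i => abs_le.1 (cbound k i))
  wlog hlt : j < k generalizing j k
  · exact this k hk j hj hjk.symm hcol.symm (lt_of_le_of_ne (not_lt.1 hlt) hjk.symm)
  rw [Finset.mem_range] at hj hk
  simp only [Prod.mk.injEq, decide_eq_decide] at hcol
  obtain ⟨hsum, hmark⟩ := hcol
  -- the block `c k \ c j` has sum `0` and does not contain `-b`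
  have hblock : ∀ i, ∑ e ∈ c k \ c j, w e i = 0 := by
    intro i
    have h1 := Finset.sum_sdiff (f := fun e => w e i) (cmono hlt.le)
    have h2 := congrFun hsum i
    linarith
  have hne : (c k \ c j).Nonempty := by
    rw [← Finset.card_pos, Finset.card_sdiff_of_subset (cmono hlt.le), ccard k (by omega),
      ccard j (by omega)]
    omega
  let U : Finset Y := S.filter fun y => Sum.inl y ∈ c k \ c j
  let V : Finset (Σ i, Fin (s i)) := Finset.univ.filter fun p => Sum.inr (Sum.inl p) ∈ c k \ c j
  have hsplit : c k \ c j = U.disjSum (V.disjSum ∅) := by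
    ext e
    rcases e with y | p | u
    · rw [Finset.inl_mem_disjSum, Finset.mem_filter]
      refine ⟨fun h => ⟨?_, h⟩, fun h => h.2⟩
      exact Finset.inl_mem_disjSum.1 (csub k (Finset.mem_sdiff.1 h).1)
    · rw [Finset.inr_mem_disjSum, Finset.inl_mem_disjSum, Finset.mem_filter]
      simp
    · rw [Finset.inr_mem_disjSum, Finset.inr_mem_disjSum, Finset.mem_sdiff]
      simpa using hmark.2
  -- In a block with sum `0` the vectors from `S` are balanced exactly by the slack units in it.
  have hU : ∀ i, ∑ y ∈ U, v y i = (V.filter fun p => p.1 = i).card := by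
    intro i
    have h := hblock i
    rw [hsplit, Finset.sum_disjSum, Finset.sum_disjSum, Finset.sum_empty, add_zero] at h
    simp only [w] at h
    rw [← Finset.sum_filter, Finset.sum_const, smul_neg, nsmul_eq_mul, mul_one] at h
    linarith
  have hVs : ∀ i, (V.filter fun p => p.1 = i).card ≤ s i := by
    intro i
    calc (V.filter fun p => p.1 = i).card
        ≤ ((Finset.univ : Finset (Fin (s i))).map
            (Function.Embedding.sigmaMk (β := fun i => Fin (s i)) i)).card := by
          refine Finset.card_le_card fun p hp => ?_
          obtain ⟨i', a⟩ := p
          obtain rfl : i' = i := (Finset.mem_filter.1 hp).2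
          simp
      _ = s i := by simp
  -- Otherwise the nonempty block would consist of negative unit vectors only and could not sum to
  -- `0`.
  have hUne : U.Nonempty := by
    by_contra hUe
    rw [Finset.not_nonempty_iff_eq_empty] at hUe
    have hVe : V = ∅ := by
      refine Finset.eq_empty_of_forall_notMem fun p hp => ?_
      have h := hU p.1
      rw [hUe, Finset.sum_empty] at h
      have h0 : (V.filter fun q => q.1 = p.1).card = 0 := by exact_mod_cast h.symm
      rw [Finset.card_eq_zero] at h0
      exact Finset.notMem_empty p (h0 ▸ Finset.mem_filter.2 ⟨hp, rfl⟩)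
    rw [hsplit, hUe, hVe] at hne
    simp at hne
  have hUS : U ⊆ S := Finset.filter_subset _ _
  -- Removing `U` lowers coordinate `i` by the number of slack units in the block, at most `s i`, so
  -- the sum stays at least `b`.
  have hle := hmin (S \ U) (by
    rw [Finset.mem_filter, Finset.mem_powerset]
    refine ⟨Finset.sdiff_subset.trans hS.1, fun i => ?_⟩
    have h1 := Finset.sum_sdiff (f := fun y => v y i) hUS
    have h2 := hU i
    have h3 := hs i
    have h4 : ((V.filter fun p => p.1 = i).card : ℤ) ≤ s i := by exact_mod_cast hVs i
    linarith)
  have := Finset.card_pos.2 hUne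
  have := Finset.card_le_card hUS
  rw [Finset.card_sdiff_of_subset hUS] at hle
  omega

/-! ### Concepts as linear inequalities. -/

namespace DLConcept

variable {α ρ : Type*}

/-- A bound for the coefficients of the linear inequality that expresses a concept; it is `0` if
the concept is not of one of the forms `∃ R.C`, `≥ n R.C`, `M r R.C`, `W r R.C`. -/
def coeffBound : DLConcept α ρ → ℕ
  | ex _ _ => 1
  -- For `n = 0` the difference of demand and contribution can be `-1`. The value is also positive
  -- for every concept carrying an inequality, so positivity recognises these concepts.
  | atLeast n _ _ => n + 1
  | more r _ _ => r.den + 1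
  | weak r _ _ => r.den + 1
  | _ => 0

/-- The right-hand side of the linear inequality that expresses a concept. -/
def demand : DLConcept α ρ → ℤ
  | ex _ _ => 1
  | atLeast n _ _ => n
  -- After multiplication by the denominator both sides are integers, so the strict inequality of `M
  -- r` gains a `1`; that of `W r` is not strict and needs `0`.
  | more _ _ _ => 1
  | _ => 0

theorem IsPart.coeffBound_pos {C : DLConcept α ρ} (h : C.IsPart) : 0 < C.coeffBound := by
  obtain ⟨R, r, E, rfl | rfl⟩ := h <;> exact Nat.succ_pos _

theorem IsAtLeast.coeffBound_pos {C : DLConcept α ρ} (h : C.IsAtLeast) : 0 < C.coeffBound := by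
  obtain ⟨R, E, rfl⟩ | ⟨n, R, E, rfl⟩ := h <;> exact Nat.succ_pos _

end DLConcept

theorem Rat.num_pos_and_num_le_den {r : ℚ} (h0 : 0 < r) (h1 : r < 1) :
    0 < r.num ∧ r.num ≤ r.den := by
  refine ⟨Rat.num_pos.2 h0, ?_⟩
  have h := Rat.num_div_den r
  have hd : (0 : ℚ) < r.den := by exact_mod_cast r.den_pos
  rw [← h, div_lt_one hd] at h1
  exact_mod_cast h1.le

namespace LTree

variable {α ρ : Type*} (H : RoleBox ρ) (T : LTree α ρ) (x : List ℕ)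

theorem nbrs_subset (R : Role ρ) : T.nbrs H R x ⊆ T.nodes := by
  classical
  exact Finset.filter_subset _ _

theorem nbrsWith_subset (R : Role ρ) (C : DLConcept α ρ) :
    T.nbrsWith H R x C ⊆ T.nbrs H R x := by
  classical
  exact Finset.filter_subset _ _

variable [Inhabited α]

/-- The left-hand side of the linear inequality that expresses a concept, where only the
neighbours of `x` in `K` are counted. -/
noncomputable def balance (K : Finset (List ℕ)) : DLConcept α ρ → ℤ
  | .ex R C => ((T.nbrsWith H R x C ∩ K).card : ℤ)
  | .atLeast _ R C => ((T.nbrsWith H R x C ∩ K).card : ℤ)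
  | .more r R C => r.den * ((T.nbrsWith H R x C ∩ K).card : ℤ) -
      r.num * ((T.nbrs H R x ∩ K).card : ℤ)
  | .weak r R C => r.num * ((T.nbrs H R x ∩ K).card : ℤ) -
      r.den * ((T.nbrsWith H R x C.compl ∩ K).card : ℤ)
  | _ => 0

theorem balance_union {K L : Finset (List ℕ)} (h : Disjoint K L) (C : DLConcept α ρ) :
    T.balance H x (K ∪ L) C = T.balance H x K C + T.balance H x L C := by
  have key : ∀ F : Finset (List ℕ), ((F ∩ (K ∪ L)).card : ℤ) = (F ∩ K).card + (F ∩ L).card := by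
    intro F
    rw [Finset.inter_union_distrib_left, Finset.card_union_of_disjoint
      (h.mono Finset.inter_subset_right Finset.inter_subset_right)]
    push_cast
    rfl
  cases C <;> simp only [balance, key] <;> ring

/-- Identifies the vector of a single neighbour `y` as the balance over `{y}`, the form in which
`exists_small_subset` is applied. -/
theorem balance_eq_sum (K : Finset (List ℕ)) (C : DLConcept α ρ) :
    T.balance H x K C = ∑ y ∈ K, T.balance H x {y} C := by
  induction K using Finset.induction_on with
  | empty => cases C <;> simp [balance]
  | insert a K ha ih =>
    rw [Finset.sum_insert ha, ← ih, Finset.insert_eq,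
      balance_union H T x (Finset.disjoint_singleton_left.2 ha)]

/-- The balance over a set with at most one neighbour is bounded. -/
theorem abs_balance_le {K : Finset (List ℕ)} (hK : ∀ R, (T.nbrs H R x ∩ K).card ≤ 1)
    {C : DLConcept α ρ} (hC : C.WF H) :
    |T.balance H x K C| ≤ C.coeffBound ∧ |C.demand - T.balance H x K C| ≤ C.coeffBound := by
  have hle : ∀ R E, (T.nbrsWith H R x E ∩ K).card ≤ (T.nbrs H R x ∩ K).card := fun R E =>
    Finset.card_le_card (Finset.inter_subset_inter_right (nbrsWith_subset H T x R E))
  -- With at most one neighbour in `K`, only three pairs of counts remain.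
  have hcases : ∀ R E, ((T.nbrsWith H R x E ∩ K).card = 0 ∧ (T.nbrs H R x ∩ K).card = 0) ∨
      ((T.nbrsWith H R x E ∩ K).card = 0 ∧ (T.nbrs H R x ∩ K).card = 1) ∨
      ((T.nbrsWith H R x E ∩ K).card = 1 ∧ (T.nbrs H R x ∩ K).card = 1) := by
    intro R E
    have h1 := hK R
    have h2 := hle R E
    omega
  rw [abs_le, abs_le]
  cases C with
  | ex R E =>
    simp only [balance, DLConcept.coeffBound, DLConcept.demand]
    rcases hcases R E with h | h | h <;> rw [h.1] <;> simp
  | atLeast n R E =>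
    simp only [balance, DLConcept.coeffBound, DLConcept.demand]
    rcases hcases R E with h | h | h <;> rw [h.1] <;> push_cast <;> omega
  | more r R E =>
    have hr := Rat.num_pos_and_num_le_den hC.1 hC.2.1
    simp only [balance, DLConcept.coeffBound, DLConcept.demand]
    rcases hcases R E with h | h | h <;> rw [h.1, h.2] <;> push_cast <;> omega
  | weak r R E =>
    have hr := Rat.num_pos_and_num_le_den hC.1 hC.2.1
    simp only [balance, DLConcept.coeffBound, DLConcept.demand]
    rcases hcases R E.compl with h | h | h <;> rw [h.1, h.2] <;> push_cast <;> omega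
  | _ => simp [balance, DLConcept.coeffBound, DLConcept.demand]

/-- A concept is satisfied at `x` if and only if the linear inequality expressing it holds. -/
theorem demand_le_balance_iff {C : DLConcept α ρ} :
    C.demand ≤ T.balance H x T.nodes C ↔ ¬ T.PartClash H x C ∧ ¬ T.AtLeastLacking H x C := by
  have h1 : ∀ R, T.nbrs H R x ∩ T.nodes = T.nbrs H R x := fun R =>
    Finset.inter_eq_left.2 (nbrs_subset H T x R)
  have h2 : ∀ R E, T.nbrsWith H R x E ∩ T.nodes = T.nbrsWith H R x E := fun R E =>
    Finset.inter_eq_left.2 ((nbrsWith_subset H T x R E).trans (nbrs_subset H T x R))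
  have hq : ∀ (r : ℚ) (a b : ℕ), (a : ℚ) ≤ r * b ↔ (r.den : ℤ) * a ≤ r.num * b := by
    intro r a b
    have hd : (0 : ℚ) < r.den := by exact_mod_cast r.den_pos
    have e : r * b = (r.num * b : ℚ) / r.den := by
      conv_lhs => rw [← Rat.num_div_den r]
      ring
    rw [e, le_div_iff₀ hd, mul_comm (a : ℚ)]
    exact_mod_cast Iff.rfl
  have hq' : ∀ (r : ℚ) (a b : ℕ), r * b < (a : ℚ) ↔ r.num * b < (r.den : ℤ) * a := by
    intro r a b
    rw [← not_le, hq, not_le]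
  cases C with
  | ex R E =>
    simp only [balance, DLConcept.demand, PartClash, AtLeastLacking, h2, not_false_eq_true,
      true_and]
    rw [← Finset.card_eq_zero]
    omega
  | atLeast n R E =>
    simp only [balance, DLConcept.demand, PartClash, AtLeastLacking, h2, not_false_eq_true,
      true_and]
    omega
  | more r R E =>
    simp only [balance, DLConcept.demand, PartClash, AtLeastLacking, h1, h2, not_false_eq_true,
      and_true, hq]
    omega
  | weak r R E =>
    simp only [balance, DLConcept.demand, PartClash, AtLeastLacking, h1, h2, not_false_eq_true,
      and_true, hq']
    omega
  | _ => simp [balance, DLConcept.demand, PartClash, AtLeastLacking]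

end LTree

/-! ### Deleting successors of a node. -/

namespace LTree

variable {α ρ : Type*} (H : RoleBox ρ) (T : LTree α ρ) (x : List ℕ)

/-- The tree obtained by deleting those successors of `x` that are not in `S`, together with all
their descendants. -/
def prune (S : Finset (List ℕ)) : LTree α ρ where
  -- The tails of an address are the node and its ancestors. The condition `y ≠ []` is needed for `x
  -- = []`, since the tail of the root is by convention `[]` again.
  nodes := T.nodes.filter fun z => ∀ y ∈ z.tails, y.tail = x → y ≠ [] → y ∈ S
  root_mem := by
    rw [Finset.mem_filter]
    refine ⟨T.root_mem, fun y hy _ hne => absurd ?_ hne⟩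
    simpa using hy
  pred_mem := by
    intro i z hz
    rw [Finset.mem_filter] at hz ⊢
    refine ⟨T.pred_mem i z hz.1, fun y hy => hz.2 y ?_⟩
    rw [List.mem_tails] at hy ⊢
    exact hy.trans (List.suffix_cons i z)
  label := T.label
  edge := T.edge

variable (S : Finset (List ℕ))

theorem mem_prune_nodes {z : List ℕ} :
    z ∈ (T.prune x S).nodes ↔ z ∈ T.nodes ∧ ∀ i, i :: x <:+ z → i :: x ∈ S := by
  simp only [prune, Finset.mem_filter, List.mem_tails]
  refine and_congr_right fun _ => ⟨fun h i hi => h _ hi rfl (by simp), fun h y hy hx hne => ?_⟩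
  obtain ⟨i, y', rfl⟩ := List.exists_cons_of_ne_nil hne
  obtain rfl : y' = x := hx
  exact h i hy

theorem prune_nodes_subset : (T.prune x S).nodes ⊆ T.nodes := fun _ h =>
  ((mem_prune_nodes T x S).1 h).1

theorem not_cons_suffix (i : ℕ) : ¬ i :: x <:+ x := fun h => by
  have := h.length_le
  simp at this

theorem mem_prune_nodes_of_agree {z : List ℕ} (hz : x <:+ z → z = x) :
    z ∈ (T.prune x S).nodes ↔ z ∈ T.nodes := by
  rw [mem_prune_nodes]
  refine ⟨fun h => h.1, fun h => ⟨h, fun i hi => ?_⟩⟩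
  obtain rfl := hz ((List.suffix_cons i x).trans hi)
  exact absurd hi (not_cons_suffix _ i)

theorem cons_mem_prune_nodes {i : ℕ} :
    i :: x ∈ (T.prune x S).nodes ↔ i :: x ∈ T.nodes ∧ i :: x ∈ S := by
  rw [mem_prune_nodes]
  refine and_congr_right fun _ => ⟨fun h => h i List.suffix_rfl, fun h j hj => ?_⟩
  rwa [hj.eq_of_length (by simp)]

theorem IsRSucc.of_prune {R : Role ρ} {y z : List ℕ} (h : (T.prune x S).IsRSucc H R y z) :
    T.IsRSucc H R y z :=
  ⟨⟨prune_nodes_subset T x S h.1.1, h.1.2⟩, h.2⟩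

theorem mem_nbrs {R : Role ρ} {y z : List ℕ} :
    y ∈ T.nbrs H R z ↔ y ∈ T.nodes ∧ (T.IsRSucc H R z y ∨ T.IsRSucc H R.Inv y z) := by
  classical
  exact Finset.mem_filter

theorem mem_nbrsWith {R : Role ρ} {C : DLConcept α ρ} {y z : List ℕ} :
    y ∈ T.nbrsWith H R z C ↔ y ∈ T.nbrs H R z ∧ C ∈ T.label y := by
  classical
  exact Finset.mem_filter

theorem prune_nbrs_subset (R : Role ρ) (z : List ℕ) :
    (T.prune x S).nbrs H R z ⊆ T.nbrs H R z := by
  intro y hy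
  rw [mem_nbrs] at hy ⊢
  exact ⟨prune_nodes_subset T x S hy.1, hy.2.imp (IsRSucc.of_prune H T x S)
    (IsRSucc.of_prune H T x S)⟩

theorem prune_nbrsWith_subset (R : Role ρ) (z : List ℕ) (C : DLConcept α ρ) :
    (T.prune x S).nbrsWith H R z C ⊆ T.nbrsWith H R z C := by
  intro y hy
  rw [mem_nbrsWith] at hy ⊢
  exact ⟨prune_nbrs_subset H T x S R z hy.1, hy.2⟩

/-- The nodes that are not successors of `x`. -/
def nonSucc : Finset (List ℕ) := T.nodes.filter fun y => ¬ (y.tail = x ∧ y ≠ [])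

/-- The successors of `x`. -/
def succs : Finset (List ℕ) := T.nodes.filter fun y => y.tail = x ∧ y ≠ []

theorem mem_succs {y : List ℕ} : y ∈ T.succs x ↔ y ∈ T.nodes ∧ ∃ i, y = i :: x := by
  rw [succs, Finset.mem_filter]
  refine and_congr_right fun _ => ⟨fun h => ?_, ?_⟩
  · obtain ⟨i, y', rfl⟩ := List.exists_cons_of_ne_nil h.2
    exact ⟨i, by rw [← h.1]; rfl⟩
  · rintro ⟨i, rfl⟩
    simp

theorem disjoint_succs_nonSucc : Disjoint (T.succs x) (T.nonSucc x) :=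
  Finset.disjoint_filter_filter_not _ _ _

theorem succs_union_nonSucc : T.succs x ∪ T.nonSucc x = T.nodes :=
  Finset.filter_union_filter_not_eq _ _

theorem mem_nonSucc {y : List ℕ} : y ∈ T.nonSucc x ↔ y ∈ T.nodes ∧ ∀ i, y ≠ i :: x := by
  have h := mem_succs T x (y := y)
  rw [succs, Finset.mem_filter] at h
  rw [nonSucc, Finset.mem_filter]
  constructor
  · exact fun hy => ⟨hy.1, fun i hi => hy.2 (h.2 ⟨hy.1, i, hi⟩).2⟩
  · exact fun hy => ⟨hy.1, fun hs => (h.1 ⟨hy.1, hs⟩).2.elim hy.2⟩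

/-- Apart from its successors, a node has at most one neighbour. -/
theorem card_nbrs_inter_nonSucc_le (R : Role ρ) :
    (T.nbrs H R x ∩ T.nonSucc x).card ≤ 1 := by
  have hsub : T.nbrs H R x ∩ T.nonSucc x ⊆ {x.tail} := by
    intro y hy
    rw [Finset.mem_inter, mem_nbrs, mem_nonSucc] at hy
    rw [Finset.mem_singleton]
    rcases hy.1.2 with h | h
    · obtain ⟨i, hi⟩ := h.1.2
      exact absurd hi (hy.2.2 i)
    · obtain ⟨i, rfl⟩ := h.1.2
      rfl
  exact (Finset.card_le_card hsub).trans (Finset.card_singleton _).le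

variable {S}

/-- A predecessor of `x` survives the pruning because `x` does, so exactly the successors outside
`S` are lost as neighbours. -/
theorem prune_nbrs_eq (hS : S ⊆ T.succs x) (hx : x ∈ T.nodes) (R : Role ρ) :
    (T.prune x S).nbrs H R x = T.nbrs H R x ∩ (S ∪ T.nonSucc x) := by
  have hx' : x ∈ (T.prune x S).nodes := (mem_prune_nodes_of_agree T x S fun _ => rfl).2 hx
  ext y
  constructor
  · intro hy
    refine Finset.mem_inter.2 ⟨prune_nbrs_subset H T x S R x hy, ?_⟩
    rw [mem_nbrs] at hy
    rw [Finset.mem_union, mem_nonSucc]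
    by_cases hi : ∃ i, y = i :: x
    · obtain ⟨i, rfl⟩ := hi
      exact Or.inl ((cons_mem_prune_nodes T x S).1 hy.1).2
    · exact Or.inr ⟨prune_nodes_subset T x S hy.1, fun i h => hi ⟨i, h⟩⟩
  · intro hy
    rw [Finset.mem_inter, mem_nbrs, Finset.mem_union] at hy
    obtain ⟨⟨hyT, hyR⟩, hyK⟩ := hy
    have hyn : y ∈ (T.prune x S).nodes := by
      rcases hyK with h | h
      · obtain ⟨i, rfl⟩ := ((mem_succs T x).1 (hS h)).2
        exact (cons_mem_prune_nodes T x S).2 ⟨hyT, h⟩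
      · rcases hyR with h' | h'
        · obtain ⟨i, hi⟩ := h'.1.2
          exact absurd hi (((mem_nonSucc T x).1 h).2 i)
        · obtain ⟨i, rfl⟩ := h'.1.2
          exact (T.prune (i :: y) S).pred_mem i y hx'
    rw [mem_nbrs]
    exact ⟨hyn, hyR.imp (fun h => ⟨⟨hyn, h.1.2⟩, h.2⟩) fun h => ⟨⟨hx', h.1.2⟩, h.2⟩⟩

theorem prune_nbrsWith_eq (hS : S ⊆ T.succs x) (hx : x ∈ T.nodes) (R : Role ρ)
    (C : DLConcept α ρ) :
    (T.prune x S).nbrsWith H R x C = T.nbrsWith H R x C ∩ (S ∪ T.nonSucc x) := by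
  ext y
  rw [mem_nbrsWith, prune_nbrs_eq H T x hS hx, Finset.mem_inter, Finset.mem_inter, mem_nbrsWith]
  exact and_right_comm

theorem card_prune_nbrs_le (hS : S ⊆ T.succs x) (hx : x ∈ T.nodes) (R : Role ρ) :
    ((T.prune x S).nbrs H R x).card ≤ S.card + 1 := by
  rw [prune_nbrs_eq H T x hS hx, Finset.inter_union_distrib_left]
  exact (Finset.card_union_le _ _).trans (add_le_add
    (Finset.card_le_card Finset.inter_subset_right) (card_nbrs_inter_nonSucc_le H T x R))

theorem AtMostClash.of_prune {z : List ℕ} (h : (T.prune x S).AtMostClash H z) :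
    T.AtMostClash H z := by
  obtain ⟨n, R, C, hm, hn⟩ := h
  exact ⟨n, R, C, hm, hn.trans_le (Finset.card_le_card (prune_nbrsWith_subset H T x S R z C))⟩

/-- Allows the `≤`-rule to be treated through clashes, which pass from the pruned tree back to the
original one. -/
theorem AtMostApplicable.atMostClash {z : List ℕ} (h : T.AtMostApplicable H z) :
    T.AtMostClash H z := by
  obtain ⟨_, n, R, C, hm, hn, _⟩ := h
  exact ⟨n, R, C, hm, hn⟩

/-- Blocking looks only at labels of a node and its ancestors and of the edges between them, and
pruning keeps the label functions. -/
theorem blocked_prune : ∀ z, (T.prune x S).Blocked z ↔ T.Blocked z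
  | [] => Iff.rfl
  | _ :: u => or_congr (blocked_prune u) Iff.rfl

theorem indirectlyBlocked_prune : ∀ z, (T.prune x S).IndirectlyBlocked z ↔ T.IndirectlyBlocked z
  | [] => Iff.rfl
  | _ :: u => or_congr (blocked_prune T x u) Iff.rfl

variable [Inhabited α]

theorem balance_prune (hS : S ⊆ T.succs x) (hx : x ∈ T.nodes) (C : DLConcept α ρ) :
    (T.prune x S).balance H x (T.prune x S).nodes C = T.balance H x (S ∪ T.nonSucc x) C := by
  have h1 : ∀ R, (T.prune x S).nbrs H R x ∩ (T.prune x S).nodes =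
      T.nbrs H R x ∩ (S ∪ T.nonSucc x) := fun R => by
    rw [Finset.inter_eq_left.2 (nbrs_subset H _ x R), prune_nbrs_eq H T x hS hx]
  have h2 : ∀ R E, (T.prune x S).nbrsWith H R x E ∩ (T.prune x S).nodes =
      T.nbrsWith H R x E ∩ (S ∪ T.nonSucc x) := fun R E => by
    rw [Finset.inter_eq_left.2 ((nbrsWith_subset H _ x R E).trans (nbrs_subset H _ x R)),
      prune_nbrsWith_eq H T x hS hx]
  cases C <;> simp only [balance, h1, h2]

/-- Pruning does not make a non-generating rule applicable. -/
theorem NonGeneratingDone.prune {z : List ℕ} (h : T.NonGeneratingDone H z)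
    (hc : ¬ T.AtMostClash H z) : (T.prune x S).NonGeneratingDone H z := by
  obtain ⟨h1, h2, h3, h4, h5, _⟩ := h
  have hb := indirectlyBlocked_prune T x (S := S) z
  refine ⟨fun h => h1 ⟨mt hb.2 h.1, h.2⟩, fun h => h2 ⟨mt hb.2 h.1, h.2⟩, ?_, ?_, ?_,
    fun h => hc (AtMostClash.of_prune H T x (AtMostApplicable.atMostClash H _ h))⟩
  · rintro ⟨hi, R, C, hm, y, hy, hC⟩
    exact h3 ⟨mt hb.2 hi, R, C, hm, y, prune_nbrs_subset H T x S R z hy, hC⟩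
  · rintro ⟨hi, R, R', C, hm, ht, hs, y, hy, hC⟩
    exact h4 ⟨mt hb.2 hi, R, R', C, hm, ht, hs, y, prune_nbrs_subset H T x S R z hy, hC⟩
  · rintro ⟨hi, R, C, hm, y, hy, hC⟩
    exact h5 ⟨mt hb.2 hi, R, C, hm, y, prune_nbrs_subset H T x S R z hy, hC⟩

/-- A tree satisfying `(P, G)` still does so after deleting successors, if the linear inequalities
expressing the concepts in `P` and `G` still hold. -/
theorem Satisfies.prune {D : DLConcept α ρ} {T₀ : LTree α ρ} {P G : Set (DLConcept α ρ)}
    (h : Satisfies H D T₀ x P G T) (hS : S ⊆ T.succs x) (hx : x ∈ T.nodes)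
    (hbal : ∀ C, C ∈ P ∨ C ∈ G → C.demand ≤ T.balance H x (S ∪ T.nonSucc x) C) :
    Satisfies H D T₀ x P G (T.prune x S) := by
  obtain ⟨⟨hD, hlab, hedge⟩, hag, hdone, _, _⟩ := h
  have hsat : ∀ C, C ∈ P ∨ C ∈ G →
      ¬ (T.prune x S).PartClash H x C ∧ ¬ (T.prune x S).AtLeastLacking H x C := fun C hC => by
    rw [← demand_le_balance_iff, balance_prune H T x hS hx]
    exact hbal C hC
  refine ⟨⟨hD, fun z hz => hlab z (prune_nodes_subset T x S hz),
    fun i z hz => hedge i z (prune_nodes_subset T x S hz)⟩, fun z hz => ?_, fun z hz hxz => ?_,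
    fun C hC => (hsat C (Or.inl hC)).1, fun C hC => (hsat C (Or.inr hC)).2⟩
  · exact ⟨(mem_prune_nodes_of_agree T x S hz).trans (hag z hz).1, (hag z hz).2⟩
  · obtain ⟨h1, h2, h3⟩ := hdone z (prune_nodes_subset T x S hz) hxz
    exact ⟨h1.prune H T x h3, h2, fun h => h3 (AtMostClash.of_prune H T x h)⟩

open Classical in
/-- Simultaneously satisfiable concepts can be satisfied with few successors. -/
theorem Satisfies.exists_few_nbrs {D : DLConcept α ρ} {T₀ : LTree α ρ}
    {P G : Set (DLConcept α ρ)} (h : Satisfies H D T₀ x P G T) (hx : x ∈ T.nodes)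
    (L : Finset (DLConcept α ρ)) (hP : ∀ C ∈ P, C ∈ L ∧ C.IsPart)
    (hG : ∀ C ∈ G, C ∈ L ∧ C.IsAtLeast) (hWF : ∀ C ∈ L, C.WF H)
    (m Δ : ℕ) (hm : (L.filter fun C => C ∈ P ∨ C ∈ G).card ≤ m) (hΔ1 : 1 ≤ Δ)
    (hΔ : ∀ C ∈ L, C.coeffBound ≤ Δ) :
    ∃ T', Satisfies H D T₀ x P G T' ∧
      ∀ R, (T'.nbrs H R x).card ≤ 2 * (2 * m * Δ + 1) ^ m + 1 := by
  -- One coordinate for each concept to be preserved.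
  let ι := {C // C ∈ L.filter fun C => C ∈ P ∨ C ∈ G}
  have hι : ∀ C : ι, C.1 ∈ L := fun C => (Finset.mem_filter.1 C.2).1
  have hbound : ∀ (C : ι) (K : Finset (List ℕ)), (∀ R, (T.nbrs H R x ∩ K).card ≤ 1) →
      |T.balance H x K C.1| ≤ Δ ∧ |C.1.demand - T.balance H x K C.1| ≤ Δ := fun C K hK => by
    have h1 := abs_balance_le H T x hK (hWF C.1 (hι C))
    have h2 : (C.1.coeffBound : ℤ) ≤ Δ := by exact_mod_cast hΔ C.1 (hι C)
    exact ⟨h1.1.trans h2, h1.2.trans h2⟩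
  -- Only successors can be deleted; the fixed contribution of the possible predecessor is moved to
  -- the right-hand side.
  obtain ⟨S, hS, hSb, hcard⟩ := exists_small_subset (ι := ι) (T.succs x)
    (fun y C => T.balance H x {y} C.1)
    (fun C => C.1.demand - T.balance H x (T.nonSucc x) C.1) Δ hΔ1
    (fun y _ C => (hbound C {y} fun R => (Finset.card_le_card Finset.inter_subset_right).trans
      (Finset.card_singleton y).le).1)
    (fun C => (hbound C _ (card_nbrs_inter_nonSucc_le H T x)).2)
    (fun C => by
      rw [← balance_eq_sum, sub_le_iff_le_add,
        ← balance_union H T x (disjoint_succs_nonSucc T x), succs_union_nonSucc,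
        demand_le_balance_iff]
      rcases (Finset.mem_filter.1 C.2).2 with hC | hC
      · refine ⟨h.2.2.2.1 _ hC, ?_⟩
        obtain ⟨R, r, E, hE | hE⟩ := (hP _ hC).2 <;> rw [hE] <;> exact id
      · refine ⟨?_, h.2.2.2.2 _ hC⟩
        obtain ⟨R, E, hE⟩ | ⟨n, R, E, hE⟩ := (hG _ hC).2 <;> rw [hE] <;> exact id)
  refine ⟨T.prune x S, h.prune H T x hS hx fun C hC => ?_, fun R => ?_⟩
  · have := hSb ⟨C, Finset.mem_filter.2 ⟨hC.elim (fun h => (hP C h).1) fun h => (hG C h).1, hC⟩⟩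
    rwa [← balance_eq_sum, sub_le_iff_le_add, ← balance_union H T x
      ((disjoint_succs_nonSucc T x).mono_left hS)] at this
  -- The final `+ 1` accounts for the predecessor.
  · refine (card_prune_nbrs_le H T x hS hx R).trans (Nat.add_le_add_right (hcard.trans ?_) 1)
    rw [Fintype.card_coe]
    refine Nat.mul_le_mul_left 2 ?_
    calc _ ≤ (2 * m * Δ + 1) ^ (L.filter fun C => C ∈ P ∨ C ∈ G).card := by gcongr
      _ ≤ _ := Nat.pow_le_pow_right (by omega) hm

end LTree

/-! ### The closure of `D`: number and size of its inequalities. -/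

theorem Role.one_le_length {ρ : Type*} (R : Role ρ) : 1 ≤ R.length := by
  cases R <;> simp [Role.length]

namespace DLConcept

variable {α ρ : Type*}

/-- The list of all sub-concepts. -/
def subs : DLConcept α ρ → List (DLConcept α ρ)
  | atom A => [atom A]
  | neg C => neg C :: C.subs
  | and C E => and C E :: (C.subs ++ E.subs)
  | or C E => or C E :: (C.subs ++ E.subs)
  | all R C => all R C :: C.subs
  | ex R C => ex R C :: C.subs
  | atLeast n R C => atLeast n R C :: C.subs
  | atMost n R C => atMost n R C :: C.subs
  | more r R C => more r R C :: C.subs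
  | weak r R C => weak r R C :: C.subs

theorem self_mem_subs (D : DLConcept α ρ) : D ∈ D.subs := by
  cases D <;> simp [subs]

theorem mem_subs_of_immSub {D E C : DLConcept α ρ} (h : E ∈ D.subs) (hC : C ∈ E.immSub) :
    C ∈ D.subs := by
  induction D with
  | atom A =>
    obtain rfl : E = atom A := by simpa [subs] using h
    exact hC.elim
  | and D₁ D₂ ih₁ ih₂ | or D₁ D₂ ih₁ ih₂ =>
    simp only [subs, List.mem_cons, List.mem_append] at h ⊢
    rcases h with rfl | h | h
    · rcases hC with rfl | rfl
      · exact Or.inr (Or.inl (self_mem_subs _))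
      · exact Or.inr (Or.inr (self_mem_subs _))
    · exact Or.inr (Or.inl (ih₁ h))
    · exact Or.inr (Or.inr (ih₂ h))
  | _ =>
    simp only [subs, List.mem_cons] at h ⊢
    rcases h with rfl | h
    · obtain rfl := hC
      exact Or.inr (self_mem_subs _)
    · exact Or.inr (by solve_by_elim)

theorem IsNNF.of_neg {C : DLConcept α ρ} (h : (neg C).IsNNF) : ∃ A, C = atom A := by
  cases C with
  | atom A => exact ⟨A, rfl⟩
  | _ => exact h.elim

theorem IsNNF.of_mem_subs {D E : DLConcept α ρ} (hD : D.IsNNF) (h : E ∈ D.subs) : E.IsNNF := by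
  induction D with
  | atom A =>
    obtain rfl : E = atom A := by simpa [subs] using h
    exact hD
  | neg C ih =>
    obtain ⟨A, rfl⟩ := hD.of_neg
    simp only [subs, List.mem_cons, List.not_mem_nil, or_false] at h
    rcases h with rfl | rfl <;> trivial
  | and D₁ D₂ ih₁ ih₂ | or D₁ D₂ ih₁ ih₂ =>
    simp only [subs, List.mem_cons, List.mem_append] at h
    rcases h with rfl | h | h
    exacts [hD, ih₁ hD.1 h, ih₂ hD.2 h]
  | _ =>
    simp only [subs, List.mem_cons] at h
    rcases h with rfl | h
    · exact hD
    · solve_by_elim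

theorem length_le_of_mem_subs {D E : DLConcept α ρ} (h : E ∈ D.subs) : E.length ≤ D.length := by
  induction D with
  | atom A =>
    obtain rfl : E = atom A := by simpa [subs] using h
    exact le_rfl
  | and D₁ D₂ ih₁ ih₂ | or D₁ D₂ ih₁ ih₂ =>
    simp only [subs, List.mem_cons, List.mem_append] at h
    rcases h with rfl | h | h
    · exact le_rfl
    · have := ih₁ h
      simp only [length]
      omega
    · have := ih₂ h
      simp only [length]
      omega
  | neg C ih | all R C ih | ex R C ih | atLeast n R C ih | atMost n R C ih | more r R C ih
  | weak r R C ih =>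
    simp only [subs, List.mem_cons] at h
    rcases h with rfl | h
    · exact le_rfl
    · have := ih h
      simp only [length]
      omega

theorem WF.immSub {H : RoleBox ρ} {C E : DLConcept α ρ} (h : C.WF H) (hE : E ∈ C.immSub) :
    E.WF H := by
  cases C with
  | atom A => exact hE.elim
  | and _ _ | or _ _ =>
    rcases hE with rfl | rfl
    exacts [h.1, h.2]
  | neg _ | all _ _ | ex _ _ =>
    obtain rfl := hE
    exact h
  | atLeast _ _ _ | atMost _ _ _ =>
    obtain rfl := hE
    exact h.2
  | more _ _ _ | weak _ _ _ =>
    obtain rfl := hE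
    exact h.2.2.2

variable [Inhabited α]

theorem IsNNF.nnf_true {C : DLConcept α ρ} (h : C.IsNNF) : nnf true C = C := by
  induction C with
  | neg C ih =>
    obtain ⟨A, rfl⟩ := h.of_neg
    rfl
  | and _ _ ih₁ ih₂ | or _ _ ih₁ ih₂ => simp [nnf, ih₁ h.1, ih₂ h.2]
  | atom A => rfl
  | all _ _ ih | ex _ _ ih | atLeast _ _ _ ih | atMost _ _ _ ih | more _ _ _ ih
  | weak _ _ _ ih => simp [nnf, ih h]

/-- Double complement is not the identity: it turns `≥ 0 R.C` into `¬A ⊔ A`. From the first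
complement on the sequence is periodic, so three variants of each concept suffice. -/
theorem IsNNF.compl_compl_compl {C : DLConcept α ρ} (h : C.IsNNF) :
    C.compl.compl.compl = C.compl := by
  unfold compl
  induction C with
  | atom A => rfl
  | neg C ih =>
    obtain ⟨A, rfl⟩ := h.of_neg
    rfl
  | and _ _ ih₁ ih₂ | or _ _ ih₁ ih₂ => simp [nnf, ih₁ h.1, ih₂ h.2]
  | atLeast n R C ih =>
    have := IsNNF.nnf_true (C := C) h
    cases n <;> simp [nnf, this]
  | atMost n R C ih =>
    have := IsNNF.nnf_true (C := C) h
    simp [nnf, this]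
  | all R C ih | ex R C ih | more r R C ih | weak r R C ih => simp [nnf, ih h]

/-- The contradiction `A ⊓ ¬ A` replacing `¬ ≥ 0 R.C`, its complement, and their sub-concepts. -/
def IsTrivial (C : DLConcept α ρ) : Prop :=
  C = and (atom default) (neg (atom default)) ∨ C = or (neg (atom default)) (atom default) ∨
    C = atom default ∨ C = neg (atom default)

theorem IsTrivial.compl {C : DLConcept α ρ} (h : C.IsTrivial) : C.compl.IsTrivial := by
  rcases h with rfl | rfl | rfl | rfl <;> simp [IsTrivial, DLConcept.compl, nnf]

theorem IsTrivial.immSub {C E : DLConcept α ρ} (h : C.IsTrivial) (hE : E ∈ C.immSub) :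
    E.IsTrivial := by
  rcases h with rfl | rfl | rfl | rfl
  · rcases hE with rfl | rfl <;> simp [IsTrivial]
  · rcases hE with rfl | rfl <;> simp [IsTrivial]
  · exact hE.elim
  · obtain rfl := hE
    simp [IsTrivial]

/-- The case `C = E` arises from atoms, the trivial case from `≥ 0 R.F`. Complementing a number
restriction leaves its inner concept alone, while the other constructors complement it. -/
theorem immSub_compl {E C : DLConcept α ρ} (hE : E.IsNNF) (hC : C ∈ E.compl.immSub) :
    C = E ∨ C.IsTrivial ∨ ∃ F ∈ E.immSub, C = F ∨ C = F.compl := by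
  unfold compl at *
  cases E with
  | neg C =>
    obtain ⟨A, rfl⟩ := hE.of_neg
    exact hC.elim
  | atLeast n R F =>
    have hF : nnf true F = F := IsNNF.nnf_true (C := F) hE
    cases n with
    | zero => exact Or.inr (Or.inl (IsTrivial.immSub (Or.inl rfl) hC))
    | succ n => simp_all [nnf, immSub]
  | atMost n R F =>
    have hF : nnf true F = F := IsNNF.nnf_true (C := F) hE
    simp_all [nnf, immSub]
  | and F G | or F G =>
    rcases hC with rfl | rfl <;> simp [immSub]
  | _ => simp_all [nnf, immSub]

theorem immSub_compl_compl {E C : DLConcept α ρ} (hE : E.IsNNF)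
    (hC : C ∈ E.compl.compl.immSub) :
    C.IsTrivial ∨ ∃ F ∈ E.immSub, C = F ∨ C = F.compl.compl := by
  unfold compl at *
  cases E with
  | neg C =>
    obtain ⟨A, rfl⟩ := hE.of_neg
    simp_all [nnf, immSub]
  | atLeast n R F =>
    have hF : nnf true F = F := IsNNF.nnf_true (C := F) hE
    cases n with
    | zero => exact Or.inl (IsTrivial.immSub (Or.inr (Or.inl rfl)) hC)
    | succ n => simp_all [nnf, immSub]
  | atMost n R F =>
    have hF : nnf true F = F := IsNNF.nnf_true (C := F) hE
    simp_all [nnf, immSub]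
  | and F G | or F G =>
    rcases hC with rfl | rfl <;> simp [immSub]
  | _ => simp_all [nnf, immSub]

/-- The concepts `E`, `∼ E` and `∼ ∼ E`; the last one may differ from `E` if a concept `≥ 0 R.C`
occurs in `E`. -/
def variants (E : DLConcept α ρ) : List (DLConcept α ρ) := [E, E.compl, E.compl.compl]

/-- The trivial concepts and the variants of sub-concepts are together closed under both closure
operations; this replaces the closure by an explicit finite list. -/
theorem Clos.mem_variants {D C : DLConcept α ρ} (hD : D.IsNNF) (h : Clos D C) :
    C.IsTrivial ∨ ∃ E ∈ D.subs, C ∈ E.variants := by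
  simp only [variants, List.mem_cons, List.not_mem_nil, or_false]
  induction h with
  | self => exact Or.inr ⟨D, self_mem_subs D, Or.inl rfl⟩
  | sub _ hE ih =>
    rcases ih with ih | ⟨F, hF, rfl | rfl | rfl⟩
    · exact Or.inl (ih.immSub hE)
    · exact Or.inr ⟨_, mem_subs_of_immSub hF hE, Or.inl rfl⟩
    · rcases immSub_compl (hD.of_mem_subs hF) hE with rfl | h | ⟨G, hG, h⟩
      · exact Or.inr ⟨_, hF, Or.inl rfl⟩
      · exact Or.inl h
      · exact Or.inr ⟨G, mem_subs_of_immSub hF hG, h.imp_right Or.inl⟩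
    · rcases immSub_compl_compl (hD.of_mem_subs hF) hE with h | ⟨G, hG, h⟩
      · exact Or.inl h
      · exact Or.inr ⟨G, mem_subs_of_immSub hF hG, h.imp_right Or.inr⟩
  | compl _ ih =>
    rcases ih with ih | ⟨F, hF, rfl | rfl | rfl⟩
    · exact Or.inl ih.compl
    · exact Or.inr ⟨_, hF, Or.inr (Or.inl rfl)⟩
    · exact Or.inr ⟨_, hF, Or.inr (Or.inr rfl)⟩
    · exact Or.inr ⟨_, hF, Or.inr (Or.inl (hD.of_mem_subs hF).compl_compl_compl)⟩

theorem succ_le_two_pow_digits (n : ℕ) : n + 1 ≤ 2 ^ digits n :=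
  (Nat.lt_size_self n).trans_le (Nat.pow_le_pow_right (by norm_num) (le_max_right _ _))

theorem coeffBound_le_of_mem_variants {E C : DLConcept α ρ} (hE : E.IsNNF)
    (hC : C ∈ E.variants) : C.coeffBound ≤ 2 ^ E.length := by
  have hpow : ∀ a b : ℕ, a ≤ b → 2 ^ a ≤ 2 ^ b := fun a b h =>
    Nat.pow_le_pow_right (by norm_num) h
  simp only [variants, compl, List.mem_cons, List.not_mem_nil, or_false] at hC
  cases E with
  | neg C =>
    obtain ⟨A, rfl⟩ := hE.of_neg
    rcases hC with rfl | rfl | rfl <;> simp [nnf, coeffBound]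
  | all R F | ex R F =>
    rcases hC with rfl | rfl | rfl <;> simp [nnf, coeffBound, Nat.one_le_two_pow]
  | atLeast n R F =>
    have h1 := succ_le_two_pow_digits n
    have h2 := hpow (digits n) (atLeast n R F).length (by simp only [length]; omega)
    cases n <;> rcases hC with rfl | rfl | rfl <;> simp only [nnf, coeffBound] <;> omega
  | atMost n R F =>
    have h1 := succ_le_two_pow_digits n
    -- The complement `≥ (n + 1) R.F` has coefficient bound `n + 2`, which costs one more binary
    -- digit; the symbol `≤` pays for it.
    have h2 := hpow (digits n + 1) (atMost n R F).length (by simp only [length]; omega)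
    rw [pow_succ] at h2
    rcases hC with rfl | rfl | rfl <;> simp only [nnf, coeffBound] <;> omega
  | more r R F =>
    have h1 := succ_le_two_pow_digits r.den
    have h2 := hpow (digits r.den) (more r R F).length (by simp only [length]; omega)
    rcases hC with rfl | rfl | rfl <;> simp only [nnf, coeffBound] <;> omega
  | weak r R F =>
    have h1 := succ_le_two_pow_digits r.den
    have h2 := hpow (digits r.den) (weak r R F).length (by simp only [length]; omega)
    rcases hC with rfl | rfl | rfl <;> simp only [nnf, coeffBound] <;> omega
  | _ => rcases hC with rfl | rfl | rfl <;> simp [nnf, coeffBound]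

/-- The list of the variants of sub-concepts that are expressed by a linear inequality. -/
def demands (D : DLConcept α ρ) : List (DLConcept α ρ) :=
  D.subs.flatMap fun E => E.variants.filter fun C => 0 < C.coeffBound

/-- Every constructor pays for its variants with its own symbols. Boolean constructors yield no
inequality; `∀` and `∃` yield at most two and own at least two symbols; number and part restrictions
yield at most three and own at least three, counting digits and role. -/
theorem length_demands_le {D : DLConcept α ρ} (hD : D.IsNNF) : D.demands.length ≤ D.length := by
  have hdig : ∀ n, 1 ≤ digits n := fun n => le_max_left _ _
  have h3 : ∀ E : DLConcept α ρ, (E.variants.filter fun C => 0 < C.coeffBound).length ≤ 3 :=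
    fun E => List.length_filter_le _ _
  unfold demands
  induction D with
  | atom A => simp [subs, variants, compl, nnf, coeffBound]
  | neg C ih =>
    obtain ⟨A, rfl⟩ := hD.of_neg
    simp [subs, variants, compl, nnf, coeffBound]
  | and D₁ D₂ ih₁ ih₂ =>
    have h0 : ((and D₁ D₂).variants.filter fun C => 0 < C.coeffBound).length = 0 := by
      simp [variants, compl, nnf, coeffBound]
    simp only [subs, length, List.flatMap_cons, List.flatMap_append, List.length_append, h0]
    have := ih₁ hD.1
    have := ih₂ hD.2
    omega
  | or D₁ D₂ ih₁ ih₂ =>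
    have h0 : ((or D₁ D₂).variants.filter fun C => 0 < C.coeffBound).length = 0 := by
      simp [variants, compl, nnf, coeffBound]
    simp only [subs, length, List.flatMap_cons, List.flatMap_append, List.length_append, h0]
    have := ih₁ hD.1
    have := ih₂ hD.2
    omega
  | all R C ih =>
    have h0 : ((all R C).variants.filter fun C => 0 < C.coeffBound).length ≤ 2 := by
      simp [variants, compl, nnf, coeffBound]
    simp only [subs, length, List.flatMap_cons, List.length_append]
    have := ih hD
    have := R.one_le_length
    omega
  | ex R C ih =>
    have h0 : ((ex R C).variants.filter fun C => 0 < C.coeffBound).length ≤ 2 := by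
      simp [variants, compl, nnf, coeffBound]
    simp only [subs, length, List.flatMap_cons, List.length_append]
    have := ih hD
    have := R.one_le_length
    omega
  | atLeast n R C ih =>
    simp only [subs, length, List.flatMap_cons, List.length_append]
    have := ih hD
    have := R.one_le_length
    have := hdig n
    have := h3 (atLeast n R C)
    omega
  | atMost n R C ih =>
    simp only [subs, length, List.flatMap_cons, List.length_append]
    have := ih hD
    have := R.one_le_length
    have := hdig n
    have := h3 (atMost n R C)
    omega
  | more r R C ih =>
    simp only [subs, length, List.flatMap_cons, List.length_append]
    have := ih hD
    have := R.one_le_length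
    have := hdig r.den
    have := h3 (more r R C)
    omega
  | weak r R C ih =>
    simp only [subs, length, List.flatMap_cons, List.length_append]
    have := ih hD
    have := R.one_le_length
    have := hdig r.den
    have := h3 (weak r R C)
    omega

theorem IsTrivial.coeffBound_eq_zero {C : DLConcept α ρ} (h : C.IsTrivial) :
    C.coeffBound = 0 := by
  rcases h with rfl | rfl | rfl | rfl <;> rfl

/-- The additional label concepts are value restrictions `∀ R.E`, which carry no inequality. -/
theorem LabelConcept.clos_of_coeffBound_pos {H : RoleBox ρ} {D C : DLConcept α ρ}
    (h : LabelConcept H D C) (hC : 0 < C.coeffBound) : Clos D C := by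
  rcases h with h | ⟨R, S, E, rfl, _⟩
  · exact h
  · exact absurd hC (lt_irrefl 0)

theorem LabelConcept.mem_demands {H : RoleBox ρ} {D C : DLConcept α ρ} (hD : D.IsNNF)
    (h : LabelConcept H D C) (hC : 0 < C.coeffBound) : C ∈ D.demands := by
  rcases (h.clos_of_coeffBound_pos hC).mem_variants hD with ht | ⟨E, hE, hCE⟩
  · exact absurd ht.coeffBound_eq_zero hC.ne'
  · exact List.mem_flatMap.2 ⟨E, hE, List.mem_filter.2 ⟨hCE, by simpa using hC⟩⟩

theorem coeffBound_le_of_mem_demands {D C : DLConcept α ρ} (hD : D.IsNNF) (h : C ∈ D.demands) :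
    C.coeffBound ≤ 2 ^ D.length := by
  obtain ⟨E, hE, hC⟩ := List.mem_flatMap.1 h
  exact (coeffBound_le_of_mem_variants (hD.of_mem_subs hE) (List.mem_filter.1 hC).1).trans
    (Nat.pow_le_pow_right (by norm_num) (length_le_of_mem_subs hE))

theorem WF.nnf {H : RoleBox ρ} {C : DLConcept α ρ} (h : C.WF H) (b : Bool) :
    (nnf b C).WF H := by
  induction C generalizing b with
  | atom A => cases b <;> trivial
  | neg C ih => cases b <;> exact ih h _
  | and _ _ ih₁ ih₂ | or _ _ ih₁ ih₂ => cases b <;> exact ⟨ih₁ h.1 _, ih₂ h.2 _⟩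
  | all _ _ ih | ex _ _ ih => cases b <;> exact ih h _
  | atLeast n R C ih =>
    cases b
    · cases n
      · exact ⟨trivial, trivial⟩
      · exact ⟨h.1, ih h.2 _⟩
    · exact ⟨h.1, ih h.2 _⟩
  | atMost n R C ih => cases b <;> exact ⟨h.1, ih h.2 _⟩
  | more _ _ _ ih | weak _ _ _ ih => cases b <;> exact ⟨h.1, h.2.1, h.2.2.1, ih h.2.2.2 _⟩

theorem Clos.wf {H : RoleBox ρ} {D C : DLConcept α ρ} (hD : D.WF H) (h : Clos D C) :
    C.WF H := by
  induction h with
  | self => exact hD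
  | sub _ hE ih => exact ih.immSub hE
  | compl _ ih => exact ih.nnf false

theorem LabelConcept.wf {H : RoleBox ρ} {D C : DLConcept α ρ} (hD : D.WF H)
    (h : LabelConcept H D C) : C.WF H := by
  rcases h with h | ⟨R, S, E, rfl, h, _⟩
  · exact h.wf hD
  · have := h.wf hD
    exact this

end DLConcept

/-! ### The numerical bound and its computability. -/

section Bound

/-- The bound for the number of neighbours, computed from the number `m` of linear inequalities
and a bound `Δ` for their coefficients. -/
def nbrBound (m Δ : ℕ) : ℕ := 2 * (2 * m * Δ + 1) ^ m + 1

/-- The base is at most `(2n)² 2^n`, hence its power at most `(2n)^(2n) 2^(n²)`. The outer `2 * _ +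
1` costs at most a factor `4`, and `n² + 2 ≤ 4n² + 3n`. -/
theorem nbrBound_le {n m Δ : ℕ} (hn : 1 ≤ n) (hm : m ≤ n) (hΔ : Δ ≤ n * 2 ^ n + 1) :
    nbrBound m Δ ≤ (2 * n) ^ (2 * n) * 2 ^ (4 * n ^ 2 + 3 * n) := by
  have h2 : 2 ≤ 2 ^ n := by
    calc 2 = 2 ^ 1 := rfl
      _ ≤ 2 ^ n := Nat.pow_le_pow_right (by norm_num) hn
  have hbase : 2 * m * Δ + 1 ≤ (2 * n) ^ 2 * 2 ^ n := by
    calc 2 * m * Δ + 1 ≤ 2 * n * (n * 2 ^ n + 1) + 1 := by gcongr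
      _ ≤ (2 * n) ^ 2 * 2 ^ n := by nlinarith [Nat.mul_le_mul hn hn, Nat.mul_le_mul_left (n * n) h2]
  have hpow : (2 * m * Δ + 1) ^ m ≤ (2 * n) ^ (2 * n) * 2 ^ (n * n) := by
    calc (2 * m * Δ + 1) ^ m ≤ (2 * m * Δ + 1) ^ n := Nat.pow_le_pow_right (by omega) hm
      _ ≤ ((2 * n) ^ 2 * 2 ^ n) ^ n := Nat.pow_le_pow_left hbase n
      _ = _ := by rw [mul_pow, ← pow_mul, ← pow_mul]
  have hpos : 1 ≤ (2 * n) ^ (2 * n) * 2 ^ (n * n) :=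
    Nat.mul_pos (Nat.pow_pos (by omega)) (Nat.pow_pos (by norm_num))
  calc nbrBound m Δ ≤ 2 * ((2 * n) ^ (2 * n) * 2 ^ (n * n)) + 1 := by
        unfold nbrBound
        gcongr
    _ ≤ (2 * n) ^ (2 * n) * 2 ^ (n * n + 2) := by
        have : (2 * n) ^ (2 * n) * 2 ^ (n * n + 2) = 4 * ((2 * n) ^ (2 * n) * 2 ^ (n * n)) := by
          rw [pow_add]
          ring
        omega
    _ ≤ _ := Nat.mul_le_mul_left _ (Nat.pow_le_pow_right (by norm_num) (by nlinarith))

theorem primrec_nbrBound : Primrec₂ nbrBound := by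
  have hpow : Primrec₂ fun a b : ℕ => a ^ b := Primrec₂.unpaired'.1 Nat.Primrec.pow
  have hmul : Primrec₂ fun a b : ℕ => a * b := Primrec.nat_mul
  have h2 : Primrec fun p : ℕ × ℕ => 2 * p.1 * p.2 + 1 :=
    Primrec.succ.comp (hmul.comp (hmul.comp (Primrec.const 2) Primrec.fst) Primrec.snd)
  exact Primrec.succ.comp (hmul.comp (Primrec.const 2) (hpow.comp h2 Primrec.fst))

theorem Primrec.list_sum_map {β : Type*} [Primcodable β] {g : β → ℕ} (hg : Primrec g) :
    Primrec fun l : List β => (l.map g).sum := by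
  have h : Primrec fun l : List β => l.foldr (fun b s => g b + s) 0 :=
    Primrec.list_foldr Primrec.id (Primrec.const 0)
      (Primrec.nat_add.comp (hg.comp (Primrec.fst.comp Primrec.snd))
        (Primrec.snd.comp Primrec.snd)).to₂
  refine h.of_eq fun l => ?_
  induction l with
  | nil => rfl
  | cons a l ih => rw [List.foldr_cons, ih, List.map_cons, List.sum_cons]

/-- `DLConcept.coeffBound` in terms of the word that codes a concept. -/
def wordCoeffBound (w : List ℕ) : ℕ :=
  -- The tags `5`, `6`, `8`, `9` stand for `∃`, `≥`, `M`, `W`; the number of `≥` is at position `1`,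
  -- the denominators are at position `2`.
  if w.getD 0 0 = 5 then 1
  else if w.getD 0 0 = 6 then w.getD 1 0 + 1
  else if w.getD 0 0 = 8 then w.getD 2 0 + 1
  else if w.getD 0 0 = 9 then w.getD 2 0 + 1
  else 0

theorem primrec_wordCoeffBound : Primrec wordCoeffBound := by
  have hget : ∀ k, Primrec fun w : List ℕ => w.getD k 0 := fun k =>
    (Primrec.list_getD 0).comp Primrec.id (Primrec.const k)
  have heq : ∀ c, PrimrecPred fun w : List ℕ => w.getD 0 0 = c := fun c =>
    Primrec.eq.comp (hget 0) (Primrec.const c)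
  exact Primrec.ite (heq 5) (Primrec.const 1) <| Primrec.ite (heq 6) (Primrec.succ.comp (hget 1)) <|
    Primrec.ite (heq 8) (Primrec.succ.comp (hget 2)) <|
    Primrec.ite (heq 9) (Primrec.succ.comp (hget 2)) (Primrec.const 0)

variable {α ρ : Type*}

theorem wordCoeffBound_code [Encodable α] [Encodable ρ] (C : DLConcept α ρ) :
    wordCoeffBound C.code = C.coeffBound := by
  cases C <;> simp [wordCoeffBound, DLConcept.code, DLConcept.coeffBound]

/-- The bound for the number of neighbours of a node labelled with `L`. -/
def labelBound (L : Finset (DLConcept α ρ)) : ℕ :=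
  -- The first sum counts the concepts carrying an inequality, the second dominates each
  -- coefficient. The `+ 1` ensures `1 ≤ Δ`, needed for the slack unit vectors even if no concept
  -- contributes.
  nbrBound (∑ C ∈ L, min 1 C.coeffBound) (∑ C ∈ L, C.coeffBound + 1)

/-- Sums over a label do not depend on its enumeration, and each summand can be read off the code
word. -/
theorem labelComputable_labelBound [Encodable α] [Encodable ρ] :
    LabelComputable fun (L : Finset (DLConcept α ρ)) _ => labelBound L := by
  let f : List (List ℕ) → ℕ := fun l => nbrBound (l.map fun w => min 1 (wordCoeffBound w)).sum
    ((l.map wordCoeffBound).sum + 1)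
  have hf : Primrec f := primrec_nbrBound.comp
    (Primrec.list_sum_map (Primrec.nat_min.comp (Primrec.const 1) primrec_wordCoeffBound))
    (Primrec.succ.comp (Primrec.list_sum_map primrec_wordCoeffBound))
  have hL : ∀ (L : Finset (DLConcept α ρ)) (l : List (DLConcept α ρ)),
      L.val = (l : Multiset _) → labelBound L = f (l.map DLConcept.code) := by
    intro L l h
    simp only [labelBound, f, Finset.sum, h, Multiset.map_coe, Multiset.sum_coe, List.map_map]
    simp only [Function.comp_def, wordCoeffBound_code]
  exact ⟨fun l _ => f l, (hf.comp Primrec.fst).to_comp, hL, fun L _ l _ h _ => hL L l h⟩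

-- Only concepts with positive `coeffBound` contribute to the sums. They lie in `D.demands`, so
-- there are at most `n = D.length` of them, each with coefficient at most `2 ^ n`; this gives `Δ ≤
-- n * 2 ^ n + 1`.
open Classical in
theorem labelBound_le [Inhabited α] {H : RoleBox ρ} {D : DLConcept α ρ} (hD : D.IsNNF)
    {L : Finset (DLConcept α ρ)} (hL : ∀ C ∈ L, DLConcept.LabelConcept H D C) :
    labelBound L ≤ (2 * D.length) ^ (2 * D.length) * 2 ^ (4 * D.length ^ 2 + 3 * D.length) := by
  have hmem : ∀ C ∈ L.filter fun C => 0 < C.coeffBound, C ∈ D.demands := fun C hC =>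
    (hL C (Finset.mem_filter.1 hC).1).mem_demands hD (Finset.mem_filter.1 hC).2
  have hcard : (L.filter fun C => 0 < C.coeffBound).card ≤ D.length := by
    calc _ ≤ D.demands.toFinset.card :=
          Finset.card_le_card fun C hC => List.mem_toFinset.2 (hmem C hC)
      _ ≤ D.demands.length := List.toFinset_card_le _
      _ ≤ D.length := DLConcept.length_demands_le hD
  have hsum : ∀ g : DLConcept α ρ → ℕ, (∀ C, C.coeffBound = 0 → g C = 0) →
      ∑ C ∈ L, g C = ∑ C ∈ L.filter (fun C => 0 < C.coeffBound), g C := by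
    intro g hg
    refine (Finset.sum_filter_of_ne fun C _ hC => Nat.pos_of_ne_zero (mt (hg C) hC)).symm
  have hlen : 1 ≤ D.length := by
    cases D <;> simp only [DLConcept.length] <;> omega
  refine nbrBound_le hlen ?_ (Nat.add_le_add_right ?_ 1)
  · rw [hsum _ fun C hC => by rw [hC]; rfl]
    calc _ ≤ ∑ _C ∈ L.filter (fun C => 0 < C.coeffBound), 1 :=
          Finset.sum_le_sum fun C _ => min_le_left _ _
      _ ≤ D.length := by rwa [Finset.sum_const, smul_eq_mul, mul_one]
  · rw [hsum _ fun C hC => hC]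
    calc _ ≤ ∑ _C ∈ L.filter (fun C => 0 < C.coeffBound), 2 ^ D.length :=
          Finset.sum_le_sum fun C hC => DLConcept.coeffBound_le_of_mem_demands hD (hmem C hC)
      _ ≤ D.length * 2 ^ D.length := by
          rw [Finset.sum_const, smul_eq_mul]
          exact Nat.mul_le_mul_right _ hcard

end Bound

/-! ### The lemma. -/

theorem lemma6 {α ρ : Type*} [Encodable α] [Encodable ρ] [Inhabited α] :
    ∃ BAN : Finset (DLConcept α ρ) → Option (Finset (DLConcept α ρ)) → ℕ,
      LabelComputable BAN ∧
      ∀ (H : RoleBox ρ) (D : DLConcept α ρ), D.WF H → D.IsNNF →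
      ∀ T : LTree α ρ, T.IsCompletionTree H D →
      ∀ x ∈ T.nodes, T.NonGeneratingDone H x →
        1 ≤ BAN (T.label x) (T.predLabel x) ∧
        BAN (T.label x) (T.predLabel x) ≤
          (2 * D.length) ^ (2 * D.length) * 2 ^ (4 * D.length ^ 2 + 3 * D.length) ∧
        ∀ P G : Set (DLConcept α ρ),
          (∀ C ∈ P, C ∈ T.label x ∧ C.IsPart) →
          (∀ C ∈ G, C ∈ T.label x ∧ C.IsAtLeast) →
          LTree.SimSatisfiable H D T x P G →
          ∃ T' : LTree α ρ, LTree.Satisfies H D T x P G T' ∧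
            ∀ C ∈ P, ∀ R, C.IsPartOn R →
              (T'.nbrs H R x).card ≤ BAN (T.label x) (T.predLabel x) := by
  classical
  refine ⟨fun L _ => labelBound L, labelComputable_labelBound, ?_⟩
  intro H D hWF hD T hT x hx _
  have hL := hT.2.1 x hx
  refine ⟨Nat.le_add_left _ _, labelBound_le hD hL, ?_⟩
  rintro P G hP hG ⟨T₁, hT₁⟩
  have hx₁ : x ∈ T₁.nodes := (hT₁.2.1 x fun _ => rfl).1.2 hx
  -- The bound must not depend on `P` and `G`, so the dimension is estimated by the number of all
  -- label concepts that carry an inequality.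
  have hm : ((T.label x).filter fun C => C ∈ P ∨ C ∈ G).card ≤
      ∑ C ∈ T.label x, min 1 C.coeffBound := by
    rw [Finset.card_eq_sum_ones]
    refine (Finset.sum_le_sum fun C hC => ?_).trans
      (Finset.sum_le_sum_of_subset (Finset.filter_subset _ _))
    have hpos : 0 < C.coeffBound := (Finset.mem_filter.1 hC).2.elim
      (fun h => (hP C h).2.coeffBound_pos) fun h => (hG C h).2.coeffBound_pos
    exact le_min le_rfl hpos
  obtain ⟨T', hT', hcard⟩ := hT₁.exists_few_nbrs H T₁ x hx₁ (T.label x) hP hG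
    (fun C hC => (hL C hC).wf hWF) (∑ C ∈ T.label x, min 1 C.coeffBound)
    (∑ C ∈ T.label x, C.coeffBound + 1) hm (Nat.le_add_left _ _)
    (fun C hC => (Finset.single_le_sum (f := DLConcept.coeffBound) (fun _ _ => Nat.zero_le _)
      hC).trans (Nat.le_succ _))
  exact ⟨T', hT', fun _ _ R _ => hcard R⟩
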